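/- **Theorem 1 (discrete stability).** Let $\alpha\in(0,1)$. There is a constant $c>0$ depending only on $\alpha$ and, for every $T>0$, a constant $c(T)>0$ depending only on $\alpha$ and $T$, such that the following holds for all dimensions $d$, all symmetric real $d\times d$ matrices $M$ (positive definite), $C,K$ (positive semidefinite), all $J\in\mathbb N$, $J\ge1$, with $\Delta t=T/J$, and each sign $s\in\{1,-1\}$. Let $b_0=\frac{\Delta t^{1-\alpha}}{\Gamma(3-\alpha)}$ and $b_l=\frac{\Delta t^{1-\alpha}}{\Gamma(3-\alpha)}\bigl((l+1)^{2-\alpha}-2l^{2-\alpha}+(l-1)^{2-\alpha}\bigr)$ for $l\ge1$ (the Galerkin coefficients of the Abel integral operator $I^{1-\alpha}$). For vectors $v_0,v_1,\dots$ and $f_0,f_1,\dots$ in $\mathbb R^d$ put $\hat v_n=\frac{v_{n+1}+v_n}2$, $\tilde v_0=\frac{v_1+v_0}2$ and, for $n\ge1$, $\tilde v_n=\frac{v_{n+1}+2v_n+v_{n-1}}4$, $\tilde f_n=\frac{f_{n+1}+2f_n+f_{n-1}}4$; further let $r_0^n=\frac{b_{n+1}v_0+s\,b_nv_1}4$ for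 $n\ge0$. Suppose that, for some $d_0\in\mathbb R^d$, the three-stage Newmark scheme ($\gamma=\frac12$, $\beta=\frac14$) $$M\,\frac{v_{n+1}-v_{n-1}}{2\Delta t}+C\Bigl[\sum_{j=0}^n b_j\tilde v_{n-j}+r_0^n\Bigr]+K\Bigl[d_0+\Delta t\sum_{j=1}^n\frac{\tilde v_j+\tilde v_{j-1}}2\Bigr]=\tilde f_n$$ holds for $n=1,\dots,J$. Let $\hat t_{0-}=0$, $\hat t_{i-}=(i-\frac12)\Delta t$ for $1\le i\le J$, $\hat t_{i+}=(i+\frac12)\Delta t$ for $0\le i<J$, $\hat t_{J+}=T$, let $\phi_i$ be the indicator function of $[\hat t_{i-},\hat t_{i+}]$, and put $\tilde v_J(t)=\sum_{n=0}^{J}\tilde v_n\phi_n(t)$, $r_J^0(t)=\sum_{n=0}^{J}r_0^n\phi_n(t)$. For $\sigma<\frac12$ write $\|g\|_{H^\sigma(0,t)}^2=\int_{\mathbb R}(1+\omega^2)^\sigma|\mathcal F(1_{(0,t)}g)(\omega)|^2\,d\omega$, where $\mathcal F$ is the unitary Fourier transform. Then for every $N\in\{1,\dots,J\}$, with $t=\hat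 t_{N+}$, $$|M^{1/2}\hat v_N|^2+\|C^{1/2}\tilde v_J\|^2_{H^{-(1-\alpha)/2}(0,t)}+\Bigl|K^{1/2}\Delta t\sum_{n=0}^N\tilde v_n\Bigr|^2\le c(T)\Bigl(E_0+\Delta t\sum_{n=1}^N|M^{-1/2}\tilde f_n|^2\Bigr)$$ and $$\max_{1\le n\le N}|M^{1/2}\hat v_n|^2+\|C^{1/2}\tilde v_J\|^2_{H^{-(1-\alpha)/2}(0,t)}+\Bigl|K^{1/2}\Delta t\sum_{n=0}^N\tilde v_n\Bigr|^2\le c\Bigl(E_0+\Bigl(\Delta t\sum_{n=1}^N|M^{-1/2}\tilde f_n|\Bigr)^2\Bigr),$$ where $E_0=|M^{1/2}\hat v_0|^2+|K^{1/2}d_0|^2+|\Delta t\,K^{1/2}\tilde v_0|^2+\|C^{1/2}r_J^0\|^2_{H^{(1-\alpha)/2}(0,t)}$; in the case $N=1$ it is assumed in addition that $b_1^2\ne b_0b_2$, i.e. $(2^{2-\alpha}-2)^2\ne 3^{2-\alpha}-2\cdot2^{2-\alpha}+1$ (which excludes an isolated value $\alpha\approx0.639$). -/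

import Mathlib

open scoped MatrixOrder

noncomputable section

namespace FracNewmark

/-- The nonnegative square root `A^{1/2}` of a real positive semidefinite matrix. -/
def msqrt {d : ℕ} (A : Matrix (Fin d) (Fin d) ℝ) : Matrix (Fin d) (Fin d) ℝ :=
  CFC.sqrt A

/-- The matrix-vector product on Euclidean space. -/
def app {d : ℕ} (A : Matrix (Fin d) (Fin d) ℝ) (x : EuclideanSpace ℝ (Fin d)) :
    EuclideanSpace ℝ (Fin d) :=
  WithLp.toLp 2 (A.mulVec x.ofLp)

/-- The Galerkin coefficients of the Abel integral operator `I^{1-α}` for piecewise constants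
on a uniform grid with step `τ`. They do not depend on the upper index `n`. -/
def galerkinCoeff (α τ : ℝ) : ℕ → ℝ
  | 0 => τ ^ (1 - α) / Real.Gamma (3 - α)
  | l + 1 => τ ^ (1 - α) / Real.Gamma (3 - α) *
      (((l : ℝ) + 2) ^ (2 - α) - 2 * ((l : ℝ) + 1) ^ (2 - α) + (l : ℝ) ^ (2 - α))

/-- `v̂_n = (v_{n+1} + v_n) / 2`. -/
def vHat {d : ℕ} (v : ℕ → EuclideanSpace ℝ (Fin d)) (n : ℕ) : EuclideanSpace ℝ (Fin d) :=
  (1 / 2 : ℝ) • (v (n + 1) + v n)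

/-- `ṽ_0 = (v_1 + v_0) / 2` and `ṽ_n = (v_{n+1} + 2 v_n + v_{n-1}) / 4` for `n ≥ 1`. -/
def vTilde {d : ℕ} (v : ℕ → EuclideanSpace ℝ (Fin d)) : ℕ → EuclideanSpace ℝ (Fin d)
  | 0 => (1 / 2 : ℝ) • (v 1 + v 0)
  | n + 1 => (1 / 4 : ℝ) • (v (n + 2) + (2 : ℝ) • v (n + 1) + v n)

/-- `f̃_n = (f_{n+1} + 2 f_n + f_{n-1}) / 4`; used for `n ≥ 1` only. -/
def fTilde {d : ℕ} (f : ℕ → EuclideanSpace ℝ (Fin d)) (n : ℕ) : EuclideanSpace ℝ (Fin d) :=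
  (1 / 4 : ℝ) • (f (n + 1) + (2 : ℝ) • f n + f (n - 1))

/-- The initial correction `r_0^n = (b_{n+1} v_0 + s b_n v_1) / 4`, with a sign `s = ±1`. -/
def initCorr {d : ℕ} (α τ s : ℝ) (v : ℕ → EuclideanSpace ℝ (Fin d)) (n : ℕ) :
    EuclideanSpace ℝ (Fin d) :=
  (1 / 4 : ℝ) • (galerkinCoeff α τ (n + 1) • v 0 + (s * galerkinCoeff α τ n) • v 1)

/-- The three-stage form of the Newmark scheme (`γ = 1/2`, `β = 1/4`) with Galerkin coefficients
and time step `τ`, at all the steps `n = 1, …, J`. -/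
def IsSchemeSolution {d : ℕ} (M C K : Matrix (Fin d) (Fin d) ℝ) (α τ s : ℝ) (J : ℕ)
    (d₀ : EuclideanSpace ℝ (Fin d)) (v f : ℕ → EuclideanSpace ℝ (Fin d)) : Prop :=
  ∀ n ∈ Finset.Icc 1 J,
    app M ((1 / (2 * τ)) • (v (n + 1) - v (n - 1)))
      + app C (∑ j ∈ Finset.range (n + 1), galerkinCoeff α τ j • vTilde v (n - j)
          + initCorr α τ s v n)
      + app K (d₀ + τ • ∑ j ∈ Finset.Icc 1 n, (1 / 2 : ℝ) • (vTilde v j + vTilde v (j - 1)))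
    = fTilde f n

/-- The left cell end `t̂_{i-}`: `(i - 1/2) τ` with `τ = T / J`, except that `t̂_{0-} = 0`. -/
def cellLeft (T : ℝ) (J i : ℕ) : ℝ :=
  if i = 0 then 0 else ((i : ℝ) - 1 / 2) * (T / J)

/-- The right cell end `t̂_{i+}`: `(i + 1/2) τ` with `τ = T / J`, except that `t̂_{J+} = T`. -/
def cellRight (T : ℝ) (J i : ℕ) : ℝ :=
  if i = J then T else ((i : ℝ) + 1 / 2) * (T / J)

/-- The piecewise constant function `∑_{n=0}^{J} w_n φ_n(t)`, where `φ_n` is the indicator function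
of the cell `[t̂_{n-}, t̂_{n+}]`. -/
def stepFun {d : ℕ} (T : ℝ) (J : ℕ) (w : ℕ → EuclideanSpace ℝ (Fin d)) (t : ℝ) :
    EuclideanSpace ℝ (Fin d) :=
  ∑ n ∈ Finset.range (J + 1),
    (Set.Icc (cellLeft T J n) (cellRight T J n)).indicator (fun _ => w n) t

/-- The (unitary) Fourier transform at frequency `ω` of `g` restricted to `(0, t)` and extended by
zero to the real line. -/
def fourierZeroExt (t : ℝ) (g : ℝ → ℝ) (ω : ℝ) : ℂ :=
  (1 / Real.sqrt (2 * Real.pi) : ℝ) *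
    ∫ x in (0 : ℝ)..t, Complex.exp (-((ω * x : ℝ) : ℂ) * Complex.I) * ((g x : ℝ) : ℂ)

/-- The squared norm `‖g‖²_{H^σ(0,t)} = ∫ (1 + ω²)^σ |𝓕 g(ω)|² dω` (extension by zero, summed over
the components of `g`). For a step function the integrand decays like `|ω|^{2σ-2}`, so that the
integral converges whenever `σ < 1/2`. -/
def sobolevNormSq {d : ℕ} (σ t : ℝ) (g : ℝ → EuclideanSpace ℝ (Fin d)) : ℝ :=
  ∑ i : Fin d, ∫ ω : ℝ, (1 + ω ^ 2) ^ σ * ‖fourierZeroExt t (fun x => g x i) ω‖ ^ 2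

/-- The damping part and the stiffness part of the discrete energy,
`‖C^{1/2} ṽ_J‖²_{H^{-(1-α)/2}(0, t̂_{N+})} + |K^{1/2} τ ∑_{n=0}^N ṽ_n|²`. -/
def dampStiffEnergy {d : ℕ} (C K : Matrix (Fin d) (Fin d) ℝ) (α T : ℝ) (J N : ℕ)
    (v : ℕ → EuclideanSpace ℝ (Fin d)) : ℝ :=
  sobolevNormSq (-(1 - α) / 2) (cellRight T J N)
      (fun t => app (msqrt C) (stepFun T J (vTilde v) t))
    + ‖app (msqrt K) ((T / J) • ∑ n ∈ Finset.range (N + 1), vTilde v n)‖ ^ 2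

/-- The data terms `|M^{1/2} v̂_0|² + |K^{1/2} d_0|² + |τ K^{1/2} ṽ_0|²
+ ‖C^{1/2} r^0_J‖²_{H^{(1-α)/2}(0, t̂_{N+})}`. -/
def initialTerms {d : ℕ} (M C K : Matrix (Fin d) (Fin d) ℝ) (α T s : ℝ) (J N : ℕ)
    (d₀ : EuclideanSpace ℝ (Fin d)) (v : ℕ → EuclideanSpace ℝ (Fin d)) : ℝ :=
  ‖app (msqrt M) (vHat v 0)‖ ^ 2 + ‖app (msqrt K) d₀‖ ^ 2
    + ‖(T / J) • app (msqrt K) (vTilde v 0)‖ ^ 2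
    + sobolevNormSq ((1 - α) / 2) (cellRight T J N)
        (fun t => app (msqrt C) (stepFun T J (initCorr α (T / J) s v) t))

end FracNewmark

end

/-!
Testing the scheme with `ṽ_n = (v̂_n + v̂_{n-1}) / 2` turns the inertial and elastic terms into
differences of squares, so the mechanical energy changes only by the work of the load and of the
damping force. Since `b_l` is a multiple of the second difference of `|l| ^ (2 - α)`, the damping
work of a sequence is a Toeplitz form, and the Lévy-Khintchine representation
`κ |x| ^ p = ∫ (1 - cos (x θ)) |θ| ^ (-1 - p) dθ`, `p = 2 - α`, identifies it with
`∫ 2 (1 - cos θ) |θ| ^ (-1 - p) |∑ x_k e^{-ikθ}|² dθ`. By the explicit Fourier transform of a step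
function this form controls the `H^{-(1-α)/2}` norm on a uniform grid.

Two defects remain: the work sum starts at the step `1` instead of `0`, and it contains the
correction `r_0^n`. By duality the second one is paid for by the `H^{(1-α)/2}` norm of the
correction, provided that the same norm also controls `ṽ_0`. It does, because the correction
determines `v_0 ± v_1` linearly from finitely many coefficients `b_l`, which are nondegenerate.
As the cell at `0` is a half cell, all norms are compared on the grid of step `Δt / 2`.

Finally the load is absorbed at the step where `|M^{1/2} v̂_n|` is maximal.
-/

noncomputable section

namespace FracNewmark

open MeasureTheory Finset

/-- The second central difference of `|·| ^ p` with unit step. -/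
def rpowSecondDiff (p t : ℝ) : ℝ := |t + 1| ^ p - 2 * |t| ^ p + |t - 1| ^ p

theorem rpowSecondDiff_zero {p : ℝ} (hp : p ≠ 0) : rpowSecondDiff p 0 = 2 := by
  norm_num [rpowSecondDiff, Real.zero_rpow hp]

theorem rpowSecondDiff_of_one_le (p : ℝ) {t : ℝ} (ht : 1 ≤ t) :
    rpowSecondDiff p t = (t + 1) ^ p - 2 * t ^ p + (t - 1) ^ p := by
  rw [rpowSecondDiff, abs_of_nonneg (by linarith), abs_of_nonneg (by linarith),
    abs_of_nonneg (by linarith)]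

theorem secondDiff_pos_of_strictConvexOn {f : ℝ → ℝ} {s : Set ℝ} (hf : StrictConvexOn ℝ s f)
    {t : ℝ} (h₀ : t - 1 ∈ s) (h₁ : t + 1 ∈ s) : 0 < f (t + 1) - 2 * f t + f (t - 1) := by
  have h := hf.2 h₁ h₀ (by linarith) (by norm_num : (0 : ℝ) < 1 / 2)
    (by norm_num : (0 : ℝ) < 1 / 2) (by norm_num)
  rw [smul_eq_mul, smul_eq_mul, smul_eq_mul, smul_eq_mul,
    show (1 / 2 : ℝ) * (t + 1) + 1 / 2 * (t - 1) = t by ring] at h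
  linarith

theorem rpowSecondDiff_pos {p : ℝ} (hp : 1 < p) {t : ℝ} (ht : 1 ≤ t) :
    0 < rpowSecondDiff p t := by
  rw [rpowSecondDiff_of_one_le p ht]
  exact secondDiff_pos_of_strictConvexOn (strictConvexOn_rpow hp)
    (Set.mem_Ici.2 (by linarith)) (Set.mem_Ici.2 (by linarith))

theorem two_mul_rpow_lt_add {q r s : ℝ} (hq : q < 0) (hr : 0 < r) (hs : 1 < s) :
    2 * s ^ q < r * (s - 1) ^ q + r⁻¹ * (s + 1) ^ q := by
  have hs₁ : 0 < s - 1 := by linarith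
  have hs₂ : 0 < s + 1 := by linarith
  have hs₀ : 0 < s := by linarith
  have h_sq : (s ^ q) ^ 2 < (s - 1) ^ q * (s + 1) ^ q := by
    rw [sq, ← Real.mul_rpow hs₀.le hs₀.le, ← Real.mul_rpow hs₁.le hs₂.le]
    exact Real.rpow_lt_rpow_of_neg (by positivity) (by nlinarith) hq
  refine lt_of_pow_lt_pow_left₀ 2 (by positivity) ?_
  have h_amgm := four_mul_le_sq_add (r * (s - 1) ^ q) (r⁻¹ * (s + 1) ^ q)
  have h_mul : 4 * (r * (s - 1) ^ q) * (r⁻¹ * (s + 1) ^ q)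
      = 4 * ((s - 1) ^ q * (s + 1) ^ q) := by
    field_simp
  linarith [mul_pow 2 (s ^ q) 2]

theorem strictConvexOn_rpow_weighted_secondDiff {p r : ℝ} (hp₁ : 1 < p) (hp₂ : p < 2)
    (hr : 0 < r) :
    StrictConvexOn ℝ (Set.Ici 1) fun s : ℝ => r * (s - 1) ^ p + r⁻¹ * (s + 1) ^ p - 2 * s ^ p := by
  have h_deriv : ∀ s, HasDerivAt (fun s : ℝ => r * (s - 1) ^ p + r⁻¹ * (s + 1) ^ p - 2 * s ^ p)
      (p * (r * (s - 1) ^ (p - 1) + r⁻¹ * (s + 1) ^ (p - 1) - 2 * s ^ (p - 1))) s := by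
    intro s
    have h := fun c : ℝ => ((hasDerivAt_id s).add_const c).rpow_const (p := p) (.inr hp₁.le)
    have h_sum := (((h (-1)).const_mul r).add ((h 1).const_mul r⁻¹)).sub ((h 0).const_mul 2)
    simp only [id_eq, add_zero, ← sub_eq_add_neg] at h_sum
    exact h_sum.congr_deriv (by ring)
  refine strictConvexOn_of_deriv2_pos (convex_Ici 1)
    (fun s _ => (h_deriv s).continuousAt.continuousWithinAt) fun s hs => ?_
  rw [interior_Ici, Set.mem_Ioi] at hs
  have h := fun (c : ℝ) (hc : id s + c ≠ 0) =>
    ((hasDerivAt_id s).add_const c).rpow_const (p := p - 1) (.inl hc)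
  have h_sum := ((((h (-1) (by simp only [id]; linarith)).const_mul r).add
    ((h 1 (by simp only [id]; linarith)).const_mul r⁻¹)).sub
      ((h 0 (by simp only [id]; linarith)).const_mul 2)).const_mul p
  simp only [id_eq, add_zero, ← sub_eq_add_neg] at h_sum
  have h_pos := two_mul_rpow_lt_add (q := p - 1 - 1) (by linarith) hr hs
  rw [Function.iterate_succ_apply, Function.iterate_one, funext fun s => (h_deriv s).deriv]
  refine h_sum.deriv.symm ▸ ?_
  have : 0 < p * (p - 1) := mul_pos (by linarith) (by linarith)
  nlinarith

theorem sq_rpowSecondDiff_lt {p : ℝ} (hp₁ : 1 < p) (hp₂ : p < 2) {t : ℝ} (ht : 2 ≤ t) :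
    rpowSecondDiff p t ^ 2 < rpowSecondDiff p (t - 1) * rpowSecondDiff p (t + 1) := by
  have h₀ : 0 < rpowSecondDiff p (t - 1) := rpowSecondDiff_pos hp₁ (by linarith)
  have h₁ : 0 < rpowSecondDiff p t := rpowSecondDiff_pos hp₁ (by linarith)
  set r := rpowSecondDiff p t / rpowSecondDiff p (t - 1) with hr
  have h := secondDiff_pos_of_strictConvexOn
    (strictConvexOn_rpow_weighted_secondDiff hp₁ hp₂ (div_pos h₁ h₀))
    (t := t) (Set.mem_Ici.2 (by linarith)) (Set.mem_Ici.2 (by linarith))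
  have h' : 2 * rpowSecondDiff p t
      < r * rpowSecondDiff p (t - 1) + r⁻¹ * rpowSecondDiff p (t + 1) := by
    rw [rpowSecondDiff_of_one_le p (by linarith), rpowSecondDiff_of_one_le p (by linarith),
      rpowSecondDiff_of_one_le p (by linarith)]
    simp only [← hr] at h
    ring_nf at h ⊢
    linarith
  rw [hr, div_mul_cancel₀ _ h₀.ne', inv_div, div_mul_eq_mul_div, ← sub_lt_iff_lt_add',
    lt_div_iff₀ h₁] at h'
  linarith

theorem integrable_of_even {f : ℝ → ℝ} (hf : ∀ x, f (-x) = f x)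
    (h : IntegrableOn f (Set.Ioi 0)) : Integrable f := by
  rw [← integrableOn_univ, ← Set.Iic_union_Ioi (a := (0 : ℝ)), integrableOn_union,
    integrableOn_Iic_iff_integrableOn_Iio]
  have h' := IntegrableOn.comp_neg_Iio (c := 0) (f := f) (by simpa only [neg_zero] using h)
  exact ⟨by simpa only [hf] using h', h⟩

theorem one_sub_cos_mul_rpow_nonneg (q x θ : ℝ) : 0 ≤ (1 - Real.cos (x * θ)) * |θ| ^ q :=
  mul_nonneg (sub_nonneg.2 (Real.cos_le_one _)) (by positivity)

theorem integrable_one_sub_cos_mul_rpow {p : ℝ} (hp₀ : 0 < p) (hp₂ : p < 2) (x : ℝ) :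
    Integrable fun θ : ℝ => (1 - Real.cos (x * θ)) * |θ| ^ (-1 - p) := by
  have h_meas : Measurable fun θ : ℝ => (1 - Real.cos (x * θ)) * |θ| ^ (-1 - p) := by fun_prop
  refine integrable_of_even (by intro θ; simp only [mul_neg, Real.cos_neg, abs_neg]) ?_
  rw [← Set.Ioc_union_Ioi_eq_Ioi (zero_le_one' ℝ)]
  refine IntegrableOn.union ?_ ?_
  · have h_dom : IntegrableOn (fun θ : ℝ => x ^ 2 / 2 * θ ^ (1 - p)) (Set.Ioc 0 1) :=
      ((intervalIntegrable_iff_integrableOn_Ioc_of_le zero_le_one).1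
        (intervalIntegral.intervalIntegrable_rpow' (by linarith))).const_mul _
    refine Integrable.mono' h_dom h_meas.aestronglyMeasurable
      (ae_restrict_of_forall_mem measurableSet_Ioc fun θ hθ => ?_)
    have h_cos : 1 - Real.cos (x * θ) ≤ (x * θ) ^ 2 / 2 := by
      linarith [Real.one_sub_sq_div_two_le_cos (x := x * θ)]
    rw [Real.norm_of_nonneg (one_sub_cos_mul_rpow_nonneg _ _ _), abs_of_pos hθ.1]
    calc (1 - Real.cos (x * θ)) * θ ^ (-1 - p) ≤ (x * θ) ^ 2 / 2 * θ ^ (-1 - p) :=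
          mul_le_mul_of_nonneg_right h_cos (Real.rpow_nonneg hθ.1.le _)
      _ = x ^ 2 / 2 * (θ ^ (2 : ℝ) * θ ^ (-1 - p)) := by rw [Real.rpow_two]; ring
      _ = x ^ 2 / 2 * θ ^ (1 - p) := by rw [← Real.rpow_add hθ.1]; ring_nf
  · have h_dom : IntegrableOn (fun θ : ℝ => 2 * θ ^ (-1 - p)) (Set.Ioi 1) :=
      (integrableOn_Ioi_rpow_of_lt (by linarith) one_pos).const_mul _
    refine Integrable.mono' h_dom h_meas.aestronglyMeasurable
      (ae_restrict_of_forall_mem measurableSet_Ioi fun θ hθ => ?_)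
    have hθ₀ : 0 < θ := zero_lt_one.trans hθ
    rw [Real.norm_of_nonneg (one_sub_cos_mul_rpow_nonneg _ _ _), abs_of_pos hθ₀]
    exact mul_le_mul_of_nonneg_right (by linarith [Real.neg_one_le_cos (x * θ)])
      (Real.rpow_nonneg hθ₀.le _)

/-- The constant `κ` in `∫ (1 - cos (x θ)) |θ| ^ (-1 - p) dθ = κ |x| ^ p`. -/
def levyConst (p : ℝ) : ℝ := ∫ θ : ℝ, (1 - Real.cos θ) * |θ| ^ (-1 - p)

theorem integral_one_sub_cos_mul_rpow {p : ℝ} (hp : p ≠ 0) (x : ℝ) :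
    ∫ θ : ℝ, (1 - Real.cos (x * θ)) * |θ| ^ (-1 - p) = levyConst p * |x| ^ p := by
  rcases eq_or_ne x 0 with rfl | hx
  · simp [Real.zero_rpow hp]
  have hx' : 0 < |x| := abs_pos.2 hx
  have h_scale : ∀ θ : ℝ, (1 - Real.cos (x * θ)) * |θ| ^ (-1 - p)
      = |x| ^ (1 + p) * ((1 - Real.cos (x * θ)) * |x * θ| ^ (-1 - p)) := by
    intro θ
    have h_one : |x| ^ (1 + p) * |x| ^ (-1 - p) = 1 := by
      rw [← Real.rpow_add hx', show 1 + p + (-1 - p) = 0 by ring, Real.rpow_zero]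
    rw [abs_mul, Real.mul_rpow (abs_nonneg _) (abs_nonneg _)]
    linear_combination (-(1 - Real.cos (x * θ)) * |θ| ^ (-1 - p)) * h_one
  simp_rw [h_scale]
  rw [integral_const_mul,
    Measure.integral_comp_mul_left (fun θ : ℝ => (1 - Real.cos θ) * |θ| ^ (-1 - p)) x,
    smul_eq_mul, abs_inv, Real.rpow_add hx', Real.rpow_one, levyConst]
  field_simp

/-- The Fourier symbol `2 (1 - cos θ) |θ| ^ (-1 - p)` of the Toeplitz form with entries
`rpowSecondDiff p (i - j)`; near the origin it behaves like `|θ| ^ (1 - p)`. -/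
def fracSymbol (p θ : ℝ) : ℝ := 2 * (1 - Real.cos θ) * |θ| ^ (-1 - p)

theorem fracSymbol_nonneg (p θ : ℝ) : 0 ≤ fracSymbol p θ :=
  mul_nonneg (mul_nonneg zero_le_two (sub_nonneg.2 (Real.cos_le_one _))) (by positivity)

theorem integrable_fracSymbol {p : ℝ} (hp₀ : 0 < p) (hp₂ : p < 2) : Integrable (fracSymbol p) :=
  ((integrable_one_sub_cos_mul_rpow hp₀ hp₂ 1).const_mul 2).congr
    (.of_forall fun θ => by simp only [fracSymbol, one_mul, mul_assoc])

theorem integral_fracSymbol_mul_cos {p : ℝ} (hp₀ : 0 < p) (hp₂ : p < 2) (t : ℝ) :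
    ∫ θ : ℝ, fracSymbol p θ * Real.cos (t * θ) = levyConst p * rpowSecondDiff p t := by
  have h_int := integrable_one_sub_cos_mul_rpow hp₀ hp₂
  have h_eq : ∀ θ : ℝ, fracSymbol p θ * Real.cos (t * θ) =
      ((1 - Real.cos ((t + 1) * θ)) * |θ| ^ (-1 - p)
        + (1 - Real.cos ((t - 1) * θ)) * |θ| ^ (-1 - p))
        - 2 * ((1 - Real.cos (t * θ)) * |θ| ^ (-1 - p)) := by
    intro θ
    simp only [fracSymbol, add_mul, sub_mul, one_mul, Real.cos_add, Real.cos_sub]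
    ring
  simp_rw [h_eq]
  rw [integral_sub ((h_int _).fun_add (h_int _)) ((h_int t).const_mul 2),
    integral_add (h_int _) (h_int _), integral_const_mul]
  simp only [integral_one_sub_cos_mul_rpow hp₀.ne', rpowSecondDiff]
  ring

theorem integral_fracSymbol (p : ℝ) : ∫ θ, fracSymbol p θ = 2 * levyConst p := by
  simp only [levyConst, ← integral_const_mul, fracSymbol, mul_assoc]

theorem four_div_pi_sq_mul_rpow_le_fracSymbol (p : ℝ) {θ : ℝ} (hθ : θ ≠ 0) (hθπ : |θ| ≤ Real.pi) :
    4 / Real.pi ^ 2 * |θ| ^ (1 - p) ≤ fracSymbol p θ := by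
  have h_cos := Real.cos_le_one_sub_mul_cos_sq hθπ
  have h_rpow : |θ| ^ (1 - p) = θ ^ 2 * |θ| ^ (-1 - p) := by
    rw [← sq_abs, ← Real.rpow_two, ← Real.rpow_add (abs_pos.2 hθ)]; ring_nf
  rw [h_rpow, fracSymbol, ← mul_assoc]
  refine mul_le_mul_of_nonneg_right ?_ (by positivity)
  linarith [show 4 / Real.pi ^ 2 * θ ^ 2 = 2 * (2 / Real.pi ^ 2 * θ ^ 2) by ring]

theorem levyConst_pos {p : ℝ} (hp₀ : 0 < p) (hp₂ : p < 2) : 0 < levyConst p := by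
  have h : 0 < ∫ θ, fracSymbol p θ := by
    rw [integral_pos_iff_support_of_nonneg (fracSymbol_nonneg p) (integrable_fracSymbol hp₀ hp₂)]
    refine lt_of_lt_of_le (by simp) (measure_mono (s := Set.Ioo 0 1) fun θ hθ => ?_)
    have h_le := four_div_pi_sq_mul_rpow_le_fracSymbol p hθ.1.ne'
      (by rw [abs_of_pos hθ.1]; linarith [hθ.2, Real.pi_gt_three])
    have h_abs : 0 < |θ| := abs_pos.2 hθ.1.ne'
    exact ((by positivity : 0 < 4 / Real.pi ^ 2 * |θ| ^ (1 - p)).trans_le h_le).ne'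
  linarith [integral_fracSymbol p]

/-- The trigonometric polynomial `∑_{k < n} x_k e^{-ikθ}`. -/
def trigPoly (n : ℕ) (x : ℕ → ℝ) (θ : ℝ) : ℂ :=
  ∑ k ∈ range n, x k • Complex.exp (-((k * θ : ℝ) : ℂ) * Complex.I)

theorem norm_exp_neg_ofReal_mul_I (t : ℝ) : ‖Complex.exp (-(t : ℂ) * Complex.I)‖ = 1 := by
  rw [← Complex.ofReal_neg, Complex.norm_exp_ofReal_mul_I]

theorem inner_exp_neg_mul_I (s t : ℝ) :
    inner ℝ (Complex.exp (-(s : ℂ) * Complex.I)) (Complex.exp (-(t : ℂ) * Complex.I))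
      = Real.cos (s - t) := by
  rw [Complex.inner, ← Complex.exp_conj, ← Complex.exp_add, ← Complex.exp_ofReal_mul_I_re]
  congr 2
  simp only [map_mul, map_neg, Complex.conj_ofReal, Complex.conj_I, Complex.ofReal_sub]
  ring

theorem inner_trigPoly (n : ℕ) (x y : ℕ → ℝ) (θ : ℝ) :
    inner ℝ (trigPoly n x θ) (trigPoly n y θ)
      = ∑ i ∈ range n, ∑ j ∈ range n, x i * y j * Real.cos (((i : ℝ) - j) * θ) := by
  rw [trigPoly, trigPoly, sum_inner]
  simp only [inner_sum, real_inner_smul_left, real_inner_smul_right,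
    inner_exp_neg_mul_I, sub_mul, mul_assoc, mul_left_comm (y _) (x _)]

@[fun_prop]
theorem continuous_trigPoly (n : ℕ) (x : ℕ → ℝ) : Continuous (trigPoly n x) := by
  unfold trigPoly; fun_prop

theorem norm_trigPoly_le (n : ℕ) (x : ℕ → ℝ) (θ : ℝ) :
    ‖trigPoly n x θ‖ ≤ ∑ k ∈ range n, |x k| := by
  refine (norm_sum_le _ _).trans_eq (sum_congr rfl fun k _ => ?_)
  rw [norm_smul, norm_exp_neg_ofReal_mul_I, mul_one, Real.norm_eq_abs]

theorem norm_trigPoly_single {n k : ℕ} (hk : k < n) (θ : ℝ) :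
    ‖trigPoly n (Pi.single k 1) θ‖ = 1 := by
  have h_eq : trigPoly n (Pi.single k 1) θ = Complex.exp (-((k * θ : ℝ) : ℂ) * Complex.I) := by
    simp [trigPoly, Pi.single_apply, hk]
  rw [h_eq, norm_exp_neg_ofReal_mul_I]

theorem integral_mul_inner_trigPoly {μ : Measure ℝ} {w : ℝ → ℝ} (hw : Integrable w μ) (n : ℕ)
    (x y : ℕ → ℝ) :
    ∫ θ, w θ * inner ℝ (trigPoly n x θ) (trigPoly n y θ) ∂μ
      = ∑ i ∈ range n, ∑ j ∈ range n, x i * y j * ∫ θ, w θ * Real.cos (((i : ℝ) - j) * θ) ∂μ := by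
  have h_int : ∀ i j : ℕ, Integrable (fun θ =>
      x i * y j * (w θ * Real.cos (((i : ℝ) - j) * θ))) μ := fun i j =>
    (hw.mul_bdd (c := 1) (by fun_prop) (.of_forall fun θ => Real.abs_cos_le_one _)).const_mul _
  simp only [inner_trigPoly, mul_sum, ← integral_const_mul, mul_left_comm (w _)]
  rw [integral_finsetSum _ fun i _ => integrable_finsetSum _ fun j _ => h_int i j]
  exact sum_congr rfl fun i _ => integral_finsetSum _ fun j _ => h_int i j

theorem integral_cos_int_mul (k : ℤ) :
    ∫ θ in (-Real.pi)..Real.pi, Real.cos (k * θ) = if k = 0 then 2 * Real.pi else 0 := by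
  split_ifs with h
  · simp [h]; ring
  · have hk : (k : ℝ) ≠ 0 := by exact_mod_cast h
    rw [intervalIntegral.integral_comp_mul_left _ hk, integral_cos]
    simp [Real.sin_int_mul_pi]

theorem integral_inner_trigPoly (n : ℕ) (x y : ℕ → ℝ) :
    ∫ θ in Set.Icc (-Real.pi) Real.pi, inner ℝ (trigPoly n x θ) (trigPoly n y θ)
      = 2 * Real.pi * ∑ k ∈ range n, x k * y k := by
  have h_cos : ∀ i j : ℕ, ∫ θ in Set.Icc (-Real.pi) Real.pi, Real.cos (((i : ℝ) - j) * θ)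
      = if i = j then 2 * Real.pi else 0 := by
    intro i j
    rw [integral_Icc_eq_integral_Ioc, ← intervalIntegral.integral_of_le (by linarith [Real.pi_pos])]
    simpa [sub_eq_zero] using integral_cos_int_mul ((i : ℤ) - j)
  have h := integral_mul_inner_trigPoly (μ := volume.restrict (Set.Icc (-Real.pi) Real.pi))
    (w := fun _ => 1) (integrable_const _) n x y
  simp only [one_mul, h_cos, mul_ite, mul_zero, sum_ite_eq, mul_sum] at h ⊢
  rw [h]
  exact sum_congr rfl fun i hi => by rw [if_pos hi]; ring

/-- The discrete `H^{(1-p)/2}` form `∫ fracSymbol |∑_{k < n} x_k e^{-ikθ}|² dθ`. -/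
def negNormSq (p : ℝ) (n : ℕ) (x : ℕ → ℝ) : ℝ := ∫ θ, fracSymbol p θ * ‖trigPoly n x θ‖ ^ 2

/-- The discrete `H^{(p-1)/2}` form `∫_{-π}^{π} |θ|^{p-1} |∑_{k < n} x_k e^{-ikθ}|² dθ`, which
controls the dual of `negNormSq`. -/
def posNormSq (p : ℝ) (n : ℕ) (x : ℕ → ℝ) : ℝ :=
  ∫ θ in Set.Icc (-Real.pi) Real.pi, |θ| ^ (p - 1) * ‖trigPoly n x θ‖ ^ 2

theorem negNormSq_nonneg (p : ℝ) (n : ℕ) (x : ℕ → ℝ) : 0 ≤ negNormSq p n x :=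
  integral_nonneg fun θ => mul_nonneg (fracSymbol_nonneg _ _) (by positivity)

theorem posNormSq_nonneg (p : ℝ) (n : ℕ) (x : ℕ → ℝ) : 0 ≤ posNormSq p n x :=
  integral_nonneg fun θ => by positivity

theorem integrable_fracSymbol_mul_norm_sq_trigPoly {p : ℝ} (hp₀ : 0 < p) (hp₂ : p < 2) (n : ℕ)
    (x : ℕ → ℝ) : Integrable fun θ => fracSymbol p θ * ‖trigPoly n x θ‖ ^ 2 :=
  (integrable_fracSymbol hp₀ hp₂).mul_bdd (c := (∑ k ∈ range n, |x k|) ^ 2) (by fun_prop)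
    (.of_forall fun θ => by
      rw [Real.norm_of_nonneg (by positivity)]
      exact pow_le_pow_left₀ (norm_nonneg _) (norm_trigPoly_le n x θ) 2)

theorem continuous_abs_rpow {q : ℝ} (hq : 0 ≤ q) : Continuous fun θ : ℝ => |θ| ^ q :=
  continuous_abs.rpow_const fun _ => .inr hq

theorem integrableOn_rpow_mul_norm_sq_trigPoly {p : ℝ} (hp : 1 ≤ p) (n : ℕ) (x : ℕ → ℝ) :
    IntegrableOn (fun θ => |θ| ^ (p - 1) * ‖trigPoly n x θ‖ ^ 2)
      (Set.Icc (-Real.pi) Real.pi) :=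
  ((continuous_abs_rpow (by linarith)).mul (by fun_prop)).integrableOn_Icc

theorem negNormSq_eq_sum {p : ℝ} (hp₀ : 0 < p) (hp₂ : p < 2) (n : ℕ) (x : ℕ → ℝ) :
    negNormSq p n x = levyConst p *
      ∑ i ∈ range n, ∑ j ∈ range n, x i * x j * rpowSecondDiff p ((i : ℝ) - j) := by
  have h := integral_mul_inner_trigPoly (integrable_fracSymbol hp₀ hp₂) n x x
  simp only [real_inner_self_eq_norm_sq, integral_fracSymbol_mul_cos hp₀ hp₂] at h
  rw [negNormSq, h]
  simp only [mul_sum, mul_left_comm]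

theorem sq_integral_le_mul_integral {Ω : Type*} [MeasurableSpace Ω] {μ : Measure Ω}
    {f g h : Ω → ℝ} (hf : Integrable f μ) (hg : Integrable g μ) (hh : Integrable h μ)
    (hg₀ : ∀ᵐ x ∂μ, 0 ≤ g x) (hh₀ : ∀ᵐ x ∂μ, 0 ≤ h x) (hfgh : ∀ᵐ x ∂μ, f x ^ 2 ≤ g x * h x) :
    (∫ x, f x ∂μ) ^ 2 ≤ (∫ x, g x ∂μ) * ∫ x, h x ∂μ := by
  have h_quad : ∀ t : ℝ,
      0 ≤ (∫ x, g x ∂μ) * (t * t) + (2 * ∫ x, f x ∂μ) * t + ∫ x, h x ∂μ := by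
    intro t
    have h_eq : (∫ x, g x ∂μ) * (t * t) + (2 * ∫ x, f x ∂μ) * t + ∫ x, h x ∂μ
        = ∫ x, (t ^ 2 * g x + 2 * t * f x) + h x ∂μ := by
      rw [integral_add ((hg.const_mul _).fun_add (hf.const_mul _)) hh,
        integral_add (hg.const_mul _) (hf.const_mul _), integral_const_mul, integral_const_mul]
      ring
    rw [h_eq]
    refine integral_nonneg_of_ae ?_
    filter_upwards [hg₀, hh₀, hfgh] with x hgx hhx hx
    have h_amgm := two_mul_le_add_of_sq_le_mul (a := t ^ 2 * g x) (b := h x) (r := -(t * f x))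
      (by positivity) hhx (by nlinarith [sq_nonneg t])
    simp only [Pi.zero_apply]
    linarith
  have h_discrim := discrim_le_zero h_quad
  rw [discrim] at h_discrim
  linarith

theorem sq_sum_mul_le_negNormSq_mul_posNormSq {p : ℝ} (hp₁ : 1 ≤ p) (hp₂ : p < 2) (n : ℕ)
    (x y : ℕ → ℝ) :
    (∑ k ∈ range n, x k * y k) ^ 2 ≤ 1 / 16 * (negNormSq p n x * posNormSq p n y) := by
  have h_neg := integrable_fracSymbol_mul_norm_sq_trigPoly (by linarith) hp₂ n x
  have h_cs : (∫ θ in Set.Icc (-Real.pi) Real.pi, inner ℝ (trigPoly n x θ) (trigPoly n y θ)) ^ 2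
      ≤ (∫ θ in Set.Icc (-Real.pi) Real.pi,
          Real.pi ^ 2 / 4 * (fracSymbol p θ * ‖trigPoly n x θ‖ ^ 2)) * posNormSq p n y := by
    refine sq_integral_le_mul_integral
      (((continuous_trigPoly n x).inner (continuous_trigPoly n y)).integrableOn_Icc)
      (h_neg.const_mul _).integrableOn (integrableOn_rpow_mul_norm_sq_trigPoly hp₁ n y)
      (.of_forall fun θ => ?_) (.of_forall fun θ => by positivity) ?_
    · have := fracSymbol_nonneg p θ
      positivity
    filter_upwards [ae_restrict_mem measurableSet_Icc,
      ae_restrict_of_ae (volume.ae_ne (0 : ℝ))] with θ hθ hθ₀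
    have h_rpow : |θ| ^ (1 - p) * |θ| ^ (p - 1) = 1 := by
      rw [← Real.rpow_add (abs_pos.2 hθ₀), sub_add_sub_cancel', sub_self, Real.rpow_zero]
    have h_weight : 1 ≤ Real.pi ^ 2 / 4 * fracSymbol p θ * |θ| ^ (p - 1) := by
      calc (1 : ℝ) = Real.pi ^ 2 / 4 * (4 / Real.pi ^ 2 * |θ| ^ (1 - p)) * |θ| ^ (p - 1) := by
            field_simp; exact h_rpow.symm
        _ ≤ Real.pi ^ 2 / 4 * fracSymbol p θ * |θ| ^ (p - 1) := by
            gcongr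
            exact four_div_pi_sq_mul_rpow_le_fracSymbol p hθ₀ (abs_le.2 hθ)
    calc inner ℝ (trigPoly n x θ) (trigPoly n y θ) ^ 2
        ≤ (‖trigPoly n x θ‖ * ‖trigPoly n y θ‖) ^ 2 := sq_le_sq.2 <| by
          simpa only [abs_mul, abs_norm] using abs_real_inner_le_norm _ _
      _ ≤ Real.pi ^ 2 / 4 * fracSymbol p θ * |θ| ^ (p - 1)
          * (‖trigPoly n x θ‖ * ‖trigPoly n y θ‖) ^ 2 :=
        le_mul_of_one_le_left (sq_nonneg _) h_weight
      _ = _ := by ring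
  have h_mono : ∫ θ in Set.Icc (-Real.pi) Real.pi, fracSymbol p θ * ‖trigPoly n x θ‖ ^ 2
      ≤ negNormSq p n x :=
    setIntegral_le_integral h_neg (.of_forall fun θ =>
      mul_nonneg (fracSymbol_nonneg _ _) (by positivity))
  rw [integral_inner_trigPoly, integral_const_mul] at h_cs
  have h_bound := h_cs.trans (mul_le_mul_of_nonneg_right
    (mul_le_mul_of_nonneg_left h_mono (by positivity : 0 ≤ Real.pi ^ 2 / 4))
    (posNormSq_nonneg p n y))
  refine le_of_mul_le_mul_left ?_ (by positivity : 0 < 4 * Real.pi ^ 2)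
  linarith

theorem sum_single_mul {n k : ℕ} (hk : k < n) (x : ℕ → ℝ) :
    ∑ j ∈ range n, (Pi.single k 1 : ℕ → ℝ) j * x j = x k := by
  simp [Pi.single_apply, hk]

theorem negNormSq_single (p : ℝ) {n k : ℕ} (hk : k < n) :
    negNormSq p n (Pi.single k 1) = 2 * levyConst p := by
  simp only [negNormSq, norm_trigPoly_single hk, one_pow, mul_one, integral_fracSymbol]

theorem posNormSq_single_le {p : ℝ} (hp : 1 ≤ p) {n k : ℕ} (hk : k < n) :
    posNormSq p n (Pi.single k 1) ≤ 2 * Real.pi ^ p := by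
  have hπ := Real.pi_pos
  simp only [posNormSq, norm_trigPoly_single hk, one_pow, mul_one]
  calc ∫ θ in Set.Icc (-Real.pi) Real.pi, |θ| ^ (p - 1)
      ≤ ∫ _ in Set.Icc (-Real.pi) Real.pi, Real.pi ^ (p - 1) :=
        setIntegral_mono_on (continuous_abs_rpow (by linarith)).integrableOn_Icc
          (integrable_const _) measurableSet_Icc fun θ hθ =>
          Real.rpow_le_rpow (abs_nonneg _) (abs_le.2 hθ) (by linarith)
    _ = 2 * Real.pi ^ p := by
        rw [setIntegral_const, Real.volume_real_Icc_of_le (by linarith), smul_eq_mul,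
          Real.rpow_sub_one hπ.ne']
        field_simp
        ring

theorem sq_le_negNormSq {p : ℝ} (hp₁ : 1 ≤ p) (hp₂ : p < 2) {n k : ℕ} (hk : k < n)
    (x : ℕ → ℝ) : x k ^ 2 ≤ Real.pi ^ p / 8 * negNormSq p n x := by
  have h := sq_sum_mul_le_negNormSq_mul_posNormSq hp₁ hp₂ n x (Pi.single k 1)
  simp only [mul_comm (x _), sum_single_mul hk] at h
  have h_le := mul_le_mul_of_nonneg_left (posNormSq_single_le hp₁ hk) (negNormSq_nonneg p n x)
  linarith

theorem sq_le_posNormSq {p : ℝ} (hp₁ : 1 ≤ p) (hp₂ : p < 2) {n k : ℕ} (hk : k < n)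
    (y : ℕ → ℝ) : y k ^ 2 ≤ levyConst p / 8 * posNormSq p n y := by
  have h := sq_sum_mul_le_negNormSq_mul_posNormSq hp₁ hp₂ n (Pi.single k 1) y
  rw [sum_single_mul hk, negNormSq_single p hk] at h
  linarith

/-- The refinement of a sequence to the grid of half the step: cell `0` consists of the half cell
`0`, and cell `m ≥ 1` of the half cells `2 m - 1` and `2 m`. -/
def halfSeq {R : Type*} (f : ℕ → R) (k : ℕ) : R := f ((k + 1) / 2)

theorem add_add_sq_le (a b c : ℝ) : (a + b + c) ^ 2 ≤ 3 * (a ^ 2 + b ^ 2 + c ^ 2) := by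
  linarith [sq_nonneg (a - b), sq_nonneg (a - c), sq_nonneg (b - c)]

theorem mul_sum_halfSeq {R : Type*} [CommRing R] (f : ℕ → R) (z : R) (n : ℕ) :
    z * ∑ k ∈ range n, halfSeq f k * z ^ k + f 0 + (if Even n then f (n / 2) else 0) * z ^ (n + 1)
      = (1 + z) * ∑ m ∈ range (n / 2 + 1), f m * (z ^ 2) ^ m := by
  induction n with
  | zero => simp; ring
  | succ n ih =>
    obtain ⟨N, rfl | rfl⟩ := Nat.even_or_odd' n
    · have h_div : (2 * N + 1) / 2 = N := by omega
      rw [if_pos (even_two_mul N), Nat.mul_div_cancel_left _ two_pos] at ih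
      rw [if_neg (by simp), h_div, ← ih, sum_range_succ, halfSeq, h_div]
      ring
    · have h_div : (2 * N + 1 + 1) / 2 = N + 1 := by omega
      rw [if_neg (by simp), show (2 * N + 1) / 2 = N by omega] at ih
      rw [if_pos ⟨N + 1, by ring⟩, h_div, sum_range_succ _ (N + 1), mul_add (1 + z), ← ih,
        sum_range_succ, halfSeq, h_div]
      ring

theorem trigPoly_eq_sum_pow (n : ℕ) (x : ℕ → ℝ) (θ : ℝ) :
    trigPoly n x θ = ∑ k ∈ range n, (x k : ℂ) * Complex.exp (-(θ : ℂ) * Complex.I) ^ k := by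
  refine sum_congr rfl fun k _ => ?_
  rw [← Complex.exp_nat_mul, Complex.real_smul]
  congr 2
  push_cast
  ring

theorem norm_one_add_exp_sq (θ : ℝ) :
    ‖1 + Complex.exp (-(θ : ℂ) * Complex.I)‖ ^ 2 = 2 * (1 + Real.cos θ) := by
  have h_inner := inner_exp_neg_mul_I 0 θ
  rw [Complex.ofReal_zero, neg_zero, zero_mul, Complex.exp_zero, zero_sub, Real.cos_neg] at h_inner
  rw [norm_add_sq_real, h_inner, norm_exp_neg_ofReal_mul_I, norm_one]
  ring

theorem norm_sq_trigPoly_halfSeq_le (n : ℕ) (x : ℕ → ℝ) (θ : ℝ) :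
    ‖trigPoly n (halfSeq x) θ‖ ^ 2 ≤ 3 * (2 * (1 + Real.cos θ) *
      ‖trigPoly (n / 2 + 1) x (2 * θ)‖ ^ 2 + x 0 ^ 2 + x (n / 2) ^ 2) := by
  set z := Complex.exp (-(θ : ℂ) * Complex.I) with hz
  have hz₁ : ‖z‖ = 1 := norm_exp_neg_ofReal_mul_I θ
  have hz₂ : Complex.exp (-((2 * θ : ℝ) : ℂ) * Complex.I) = z ^ 2 := by
    rw [hz, ← Complex.exp_nat_mul]; congr 1; push_cast; ring
  set e : ℂ := if Even n then (x (n / 2) : ℂ) else 0 with he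
  have he_le : ‖e‖ ≤ |x (n / 2)| := by
    rw [he]; split_ifs <;> simp
  have h_eq : z * trigPoly n (halfSeq x) θ
      = (1 + z) * trigPoly (n / 2 + 1) x (2 * θ) - (x 0 : ℂ) - e * z ^ (n + 1) := by
    have h := mul_sum_halfSeq (fun k => (x k : ℂ)) z n
    rw [trigPoly_eq_sum_pow, trigPoly_eq_sum_pow, hz₂, ← h]
    simp only [halfSeq]
    ring
  have h_norm : ‖trigPoly n (halfSeq x) θ‖
      ≤ ‖1 + z‖ * ‖trigPoly (n / 2 + 1) x (2 * θ)‖ + |x 0| + |x (n / 2)| := by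
    calc ‖trigPoly n (halfSeq x) θ‖ = ‖z * trigPoly n (halfSeq x) θ‖ := by
          rw [norm_mul, hz₁, one_mul]
      _ ≤ ‖(1 + z) * trigPoly (n / 2 + 1) x (2 * θ)‖ + ‖(x 0 : ℂ)‖ + ‖e * z ^ (n + 1)‖ := by
          rw [h_eq]
          exact (norm_sub_le _ _).trans (add_le_add_left (norm_sub_le _ _) _)
      _ ≤ _ := by
          rw [norm_mul, norm_mul e, norm_pow, hz₁, one_pow, mul_one, Complex.norm_real,
            Real.norm_eq_abs]
          exact add_le_add_right he_le _
  calc ‖trigPoly n (halfSeq x) θ‖ ^ 2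
      ≤ (‖1 + z‖ * ‖trigPoly (n / 2 + 1) x (2 * θ)‖ + |x 0| + |x (n / 2)|) ^ 2 :=
        pow_le_pow_left₀ (norm_nonneg _) h_norm 2
    _ ≤ _ := add_add_sq_le _ _ _
    _ = _ := by rw [mul_pow, norm_one_add_exp_sq, sq_abs, sq_abs]

theorem fracSymbol_mul_one_add_cos (p θ : ℝ) :
    fracSymbol p θ * (2 * (1 + Real.cos θ)) = 2 ^ (1 + p) * fracSymbol p (2 * θ) := by
  have h_one : (2 : ℝ) ^ (1 + p) * 2 ^ (-1 - p) = 1 := by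
    rw [← Real.rpow_add two_pos, show 1 + p + (-1 - p) = 0 by ring, Real.rpow_zero]
  rw [fracSymbol, fracSymbol, abs_mul, Real.mul_rpow (abs_nonneg _) (abs_nonneg _), abs_two,
    Real.cos_two_mul]
  linear_combination (-2 * (1 - (2 * Real.cos θ ^ 2 - 1)) * |θ| ^ (-1 - p)) * h_one

theorem negNormSq_halfSeq_le {p : ℝ} (hp₁ : 1 ≤ p) (hp₂ : p < 2) (n : ℕ) (x : ℕ → ℝ) :
    negNormSq p n (halfSeq x)
      ≤ (3 * 2 ^ p + 3 / 2 * levyConst p * Real.pi ^ p) * negNormSq p (n / 2 + 1) x := by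
  have hp₀ : 0 < p := by linarith
  set g : ℝ → ℝ := fun θ => fracSymbol p θ * ‖trigPoly (n / 2 + 1) x θ‖ ^ 2
  have h_int : Integrable fun θ => g (2 * θ) :=
    (integrable_comp_mul_left_iff g two_ne_zero).2
      (integrable_fracSymbol_mul_norm_sq_trigPoly hp₀ hp₂ _ x)
  have h_int_symbol := integrable_fracSymbol hp₀ hp₂
  have h_scale : ∫ θ, g (2 * θ) = 1 / 2 * negNormSq p (n / 2 + 1) x := by
    rw [Measure.integral_comp_mul_left g 2, smul_eq_mul, abs_of_pos (by norm_num), inv_eq_one_div]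
    rfl
  have h_le : negNormSq p n (halfSeq x)
      ≤ ∫ θ, (3 * 2 ^ (1 + p) * g (2 * θ) + 3 * (x 0 ^ 2 + x (n / 2) ^ 2) * fracSymbol p θ) := by
    refine integral_mono (integrable_fracSymbol_mul_norm_sq_trigPoly hp₀ hp₂ _ _)
      ((h_int.const_mul _).add (h_int_symbol.const_mul _)) fun θ => ?_
    refine (mul_le_mul_of_nonneg_left (norm_sq_trigPoly_halfSeq_le n x θ)
      (fracSymbol_nonneg p θ)).trans_eq ?_
    linear_combination 3 * ‖trigPoly (n / 2 + 1) x (2 * θ)‖ ^ 2 * fracSymbol_mul_one_add_cos p θ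
  rw [integral_add (h_int.const_mul _) (h_int_symbol.const_mul _), integral_const_mul,
    integral_const_mul, h_scale, integral_fracSymbol, Real.rpow_add two_pos, Real.rpow_one] at h_le
  have h_ends := mul_le_mul_of_nonneg_left (add_le_add
    (sq_le_negNormSq hp₁ hp₂ (Nat.succ_pos (n / 2)) x)
    (sq_le_negNormSq hp₁ hp₂ (Nat.lt_succ_self (n / 2)) x)) (levyConst_pos hp₀ hp₂).le
  linarith

theorem two_mul_sum_Icc_mul (x q : ℕ → ℝ) (n : ℕ) :
    2 * ∑ m ∈ Icc 1 (n / 2), x m * q m = (∑ k ∈ range n, halfSeq x k * halfSeq q k)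
      + -(x 0 * q 0) + if Even n then x (n / 2) * q (n / 2) else 0 := by
  have h := mul_sum_halfSeq (fun m => x m * q m) 1 n
  simp only [one_pow, mul_one, one_mul, range_eq_Ico,
    sum_eq_sum_Ico_succ_bot (Nat.succ_pos (n / 2))] at h
  rw [range_eq_Ico, show Icc 1 (n / 2) = Ico (0 + 1) (n / 2 + 1) from rfl]
  simp only [halfSeq] at h ⊢
  linarith

theorem sq_mul_halfSeq_le {p : ℝ} (hp₁ : 1 ≤ p) (hp₂ : p < 2) {n N m k : ℕ} (hm : m < N)
    (hk : k < n) (x q : ℕ → ℝ) : (x m * halfSeq q k) ^ 2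
      ≤ levyConst p * Real.pi ^ p / 64 * (negNormSq p N x * posNormSq p n (halfSeq q)) := by
  rw [mul_pow]
  calc x m ^ 2 * halfSeq q k ^ 2
      ≤ (Real.pi ^ p / 8 * negNormSq p N x) * (levyConst p / 8 * posNormSq p n (halfSeq q)) :=
        mul_le_mul (sq_le_negNormSq hp₁ hp₂ hm x) (sq_le_posNormSq hp₁ hp₂ hk _) (sq_nonneg _)
          (mul_nonneg (by positivity) (negNormSq_nonneg _ _ _))
    _ = _ := by ring

theorem exists_sq_sum_le_posNormSq_halfSeq {p : ℝ} (hp₁ : 1 ≤ p) (hp₂ : p < 2) :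
    ∃ c : ℝ, 0 < c ∧ ∀ (n : ℕ) (x q : ℕ → ℝ), (∑ m ∈ Icc 1 (n / 2), x m * q m) ^ 2
      ≤ c * (negNormSq p (n / 2 + 1) x * posNormSq p n (halfSeq q)) := by
  have hκ := levyConst_pos (by linarith) hp₂
  refine ⟨3 / 64 * (3 * 2 ^ p + 3 / 2 * levyConst p * Real.pi ^ p)
    + 3 / 128 * (levyConst p * Real.pi ^ p), by positivity, fun n x q => ?_⟩
  have hS := negNormSq_nonneg p (n / 2 + 1) x
  have hL := posNormSq_nonneg p n (halfSeq q)
  obtain rfl | hn := n.eq_zero_or_pos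
  · simpa only [Nat.zero_div, Icc_eq_empty_of_lt one_pos, sum_empty, zero_pow two_ne_zero]
      using mul_nonneg (by positivity) (mul_nonneg hS hL)
  have h_first := sq_mul_halfSeq_le hp₁ hp₂ (Nat.succ_pos (n / 2)) hn x q
  have h_last := sq_mul_halfSeq_le hp₁ hp₂ (Nat.lt_succ_self (n / 2)) (Nat.sub_lt hn one_pos) x q
  rw [halfSeq, Nat.sub_add_cancel (show 1 ≤ n from hn)] at h_last
  have h_ite : (if Even n then x (n / 2) * q (n / 2) else 0) ^ 2 ≤ (x (n / 2) * q (n / 2)) ^ 2 := by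
    split_ifs
    exacts [le_rfl, (zero_pow two_ne_zero).le.trans (sq_nonneg _)]
  have h_pair := (sq_sum_mul_le_negNormSq_mul_posNormSq hp₁ hp₂ n (halfSeq x) (halfSeq q)).trans
    (mul_le_mul_of_nonneg_left (mul_le_mul_of_nonneg_right
      (negNormSq_halfSeq_le hp₁ hp₂ n x) hL) (by norm_num))
  have h_sq := add_add_sq_le (∑ k ∈ range n, halfSeq x k * halfSeq q k) (-(x 0 * q 0))
    (if Even n then x (n / 2) * q (n / 2) else 0)
  rw [← two_mul_sum_Icc_mul, neg_sq] at h_sq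
  simp only [halfSeq, Nat.zero_add, show 1 / 2 = 0 from rfl] at h_first h_pair h_sq ⊢
  linarith

theorem galerkinCoeff_zero_pos {α τ : ℝ} (hα : α < 3) (hτ : 0 < τ) : 0 < galerkinCoeff α τ 0 :=
  div_pos (Real.rpow_pos_of_pos hτ _) (Real.Gamma_pos_of_pos (by linarith))

theorem galerkinCoeff_of_pos (α τ : ℝ) {l : ℕ} (hl : 0 < l) :
    galerkinCoeff α τ l = galerkinCoeff α τ 0 * rpowSecondDiff (2 - α) l := by
  obtain ⟨m, rfl⟩ := Nat.exists_eq_add_one.2 hl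
  rw [rpowSecondDiff_of_one_le _ (by exact_mod_cast hl)]
  simp only [galerkinCoeff]
  push_cast
  ring_nf

theorem sum_galerkinCoeff_mul_sub (α τ : ℝ) (n : ℕ) (x : ℕ → ℝ) :
    ∑ j ∈ range (n + 1), galerkinCoeff α τ j * x (n - j)
      = galerkinCoeff α τ 0
        * (x n + ∑ k ∈ range n, x k * rpowSecondDiff (2 - α) ((n : ℝ) - k)) := by
  rw [← sum_flip, sum_range_succ, Nat.sub_self, Nat.sub_zero, mul_add, mul_sum, add_comm]
  congr 1
  refine sum_congr rfl fun k hk => ?_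
  have hk' : k < n := mem_range.1 hk
  rw [Nat.sub_sub_self hk'.le, galerkinCoeff_of_pos α τ (Nat.sub_pos_of_lt hk'),
    Nat.cast_sub hk'.le]
  ring

theorem rpowSecondDiff_neg (p t : ℝ) : rpowSecondDiff p (-t) = rpowSecondDiff p t := by
  rw [rpowSecondDiff, rpowSecondDiff, abs_neg, ← abs_neg (t + 1), ← abs_neg (t - 1)]
  ring_nf

theorem sum_mul_sum_galerkinCoeff_mul {α : ℝ} (hα₀ : 0 < α) (hα₂ : α < 2) (τ : ℝ) (n : ℕ)
    (x : ℕ → ℝ) :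
    2 * levyConst (2 - α) * ∑ m ∈ range n, x m * ∑ j ∈ range (m + 1),
        galerkinCoeff α τ j * x (m - j) = galerkinCoeff α τ 0 * negNormSq (2 - α) n x := by
  rw [negNormSq_eq_sum (by linarith) (by linarith)]
  induction n with
  | zero => simp
  | succ n ih =>
    have h_symm : ∀ i : ℕ, x n * x i * rpowSecondDiff (2 - α) ((n : ℝ) - i)
        = x i * x n * rpowSecondDiff (2 - α) ((i : ℝ) - n) := fun i => by
      rw [← neg_sub (i : ℝ), rpowSecondDiff_neg, mul_comm (x n)]
    rw [sum_range_succ, mul_add, ih, sum_galerkinCoeff_mul_sub]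
    simp only [sum_range_succ, sum_add_distrib, sub_self, rpowSecondDiff_zero
      (show 2 - α ≠ 0 by linarith), ← h_symm, mul_add, mul_sum]
    have h_comm : ∀ i : ℕ, x n * x i * rpowSecondDiff (2 - α) ((n : ℝ) - i)
        = x n * (x i * rpowSecondDiff (2 - α) ((n : ℝ) - i)) := fun i => mul_assoc _ _ _
    simp only [h_comm, ← mul_sum]
    ring

theorem exists_sq_half_add_le {β γ δ : ℝ} (hΔ : β * γ ≠ δ) :
    ∃ c : ℝ, 0 < c ∧ ∀ s a b : ℝ, s ^ 2 = 1 → (1 / 2 * (a + b)) ^ 2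
      ≤ c * ((1 / 4 * (β * a + s * b)) ^ 2 + (1 / 4 * (δ * a + s * γ * b)) ^ 2) := by
  have hΔ' : β * γ - δ ≠ 0 := sub_ne_zero.2 hΔ
  refine ⟨16 * (1 + β ^ 2) * (γ ^ 2 + 1) / (β * γ - δ) ^ 2 + 8, by positivity, fun s a b hs => ?_⟩
  set u := 1 / 4 * (β * a + s * b)
  set w := 1 / 4 * (δ * a + s * γ * b)
  have h_solve : 1 / 2 * (a + b) = 2 * (1 - s * β) * ((γ * u - w) / (β * γ - δ)) + 2 * s * u := by
    field_simp
    linear_combination -((β * γ - δ) * b) * hs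
  have h_coeff : (1 - s * β) ^ 2 ≤ 2 * (1 + β ^ 2) := by
    linarith [sq_nonneg (1 + s * β), show (s * β) ^ 2 = β ^ 2 by rw [mul_pow, hs, one_mul]]
  have h_diff : (γ * u - w) ^ 2 ≤ (γ ^ 2 + 1) * (u ^ 2 + w ^ 2) := by
    linarith [sq_nonneg (γ * w + u)]
  calc (1 / 2 * (a + b)) ^ 2
      ≤ 8 * ((1 - s * β) ^ 2 * ((γ * u - w) ^ 2 / (β * γ - δ) ^ 2)) + 8 * (s ^ 2 * u ^ 2) := by
        rw [h_solve, ← div_pow]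
        linarith [sq_nonneg (2 * (1 - s * β) * ((γ * u - w) / (β * γ - δ)) - 2 * s * u)]
    _ ≤ 8 * (2 * (1 + β ^ 2) * ((γ ^ 2 + 1) * (u ^ 2 + w ^ 2) / (β * γ - δ) ^ 2))
          + 8 * (u ^ 2 + w ^ 2) := by
        rw [hs, one_mul]
        gcongr
        exact le_add_of_nonneg_right (sq_nonneg w)
    _ = _ := by ring

-- If the pair `(0, k)` is degenerate for both `k = 1` and `k = 2`, then `D₂² = D₁ D₃`, which
-- contradicts the strict log-convexity of the second differences `D`.
theorem exists_rpowSecondDiff_mul_ne {p : ℝ} (hp₁ : 1 < p) (hp₂ : p < 2) :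
    ∃ k : ℕ, 0 < k ∧ k ≤ 2 ∧
      rpowSecondDiff p 1 * rpowSecondDiff p k ≠ rpowSecondDiff p ((k + 1 : ℕ) : ℝ) ∧
      (rpowSecondDiff p 1 ^ 2 ≠ rpowSecondDiff p 2 → k = 1) := by
  by_cases h₁ : rpowSecondDiff p 1 ^ 2 = rpowSecondDiff p 2
  · refine ⟨2, two_pos, le_rfl, fun h₂ => ?_, fun h => absurd h₁ h⟩
    have h_lt := sq_rpowSecondDiff_lt hp₁ hp₂ le_rfl
    norm_num at h_lt h₂
    rw [← h₂, ← h₁] at h_lt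
    exact h_lt.ne (by ring)
  · refine ⟨1, one_pos, one_le_two, fun h => h₁ ?_, fun _ => rfl⟩
    norm_num at h
    rw [sq, h]

theorem sq_le_posNormSq_halfSeq {p : ℝ} (hp₁ : 1 ≤ p) (hp₂ : p < 2) {n k : ℕ} (hn : 0 < n)
    (hk : k ≤ n / 2) (q : ℕ → ℝ) : q k ^ 2 ≤ levyConst p / 8 * posNormSq p n (halfSeq q) := by
  have h : halfSeq q (2 * k - 1) = q k := congrArg q (by omega)
  exact h ▸ sq_le_posNormSq hp₁ hp₂ (show 2 * k - 1 < n by omega) (halfSeq q)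

theorem exists_sq_half_add_le_posNormSq {α : ℝ} (hα₀ : 0 < α) (hα₁ : α < 1) :
    ∃ c : ℝ, 0 < c ∧ ∀ (n : ℕ) (τ s a b : ℝ), s ^ 2 = 1 → 1 ≤ n / 2 →
      (2 ≤ n / 2 ∨ rpowSecondDiff (2 - α) 1 ^ 2 ≠ rpowSecondDiff (2 - α) 2) →
      (galerkinCoeff α τ 0 * (1 / 2 * (a + b))) ^ 2 ≤ c * posNormSq (2 - α) n (halfSeq fun k =>
        1 / 4 * (galerkinCoeff α τ (k + 1) * a + s * galerkinCoeff α τ k * b)) := by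
  have hp₂ : 2 - α < 2 := by linarith
  obtain ⟨k, hk₀, hk₂, hΔ, hk⟩ := exists_rpowSecondDiff_mul_ne (by linarith) hp₂
  have hκ := levyConst_pos (p := 2 - α) (by linarith) hp₂
  obtain ⟨c, hc, h_le⟩ := exists_sq_half_add_le hΔ
  refine ⟨c * (2 * (levyConst (2 - α) / 8)), by positivity, fun n τ s a b hs hn h_or => ?_⟩
  set q : ℕ → ℝ := fun k => 1 / 4 * (galerkinCoeff α τ (k + 1) * a + s * galerkinCoeff α τ k * b)
    with hq
  have hkn : k ≤ n / 2 := h_or.elim hk₂.trans fun h => (hk h).trans_le hn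
  have hq₀ : q 0 = galerkinCoeff α τ 0 * (1 / 4 * (rpowSecondDiff (2 - α) 1 * a + s * b)) := by
    simp only [hq, zero_add, galerkinCoeff_of_pos α τ one_pos, Nat.cast_one]
    ring
  have hqk : q k = galerkinCoeff α τ 0 * (1 / 4 * (rpowSecondDiff (2 - α) ((k + 1 : ℕ) : ℝ) * a
      + s * rpowSecondDiff (2 - α) k * b)) := by
    simp only [hq, galerkinCoeff_of_pos α τ hk₀, galerkinCoeff_of_pos α τ k.succ_pos]
    ring
  calc (galerkinCoeff α τ 0 * (1 / 2 * (a + b))) ^ 2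
      ≤ c * (q 0 ^ 2 + q k ^ 2) := by
        rw [hq₀, hqk, mul_pow, mul_pow (galerkinCoeff α τ 0), mul_pow (galerkinCoeff α τ 0),
          ← mul_add, mul_left_comm]
        exact mul_le_mul_of_nonneg_left (h_le s a b hs) (sq_nonneg _)
    _ ≤ c * (2 * (levyConst (2 - α) / 8) * posNormSq (2 - α) n (halfSeq q)) := by
        refine mul_le_mul_of_nonneg_left ?_ hc.le
        linarith [sq_le_posNormSq_halfSeq (by linarith) hp₂ (by omega) (n / 2).zero_le q,
          sq_le_posNormSq_halfSeq (by linarith) hp₂ (by omega) hkn q]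
    _ = _ := (mul_assoc _ _ _).symm

/-- The work `τ ∑_{m=1}^n ⟨x_m, ∑_{j ≤ m} b_j x_{m-j} + q_m⟩` done against the damping force over
the steps `1, …, n`, where `b_j` are the Galerkin coefficients. -/
def dampingWork {E : Type*} [NormedAddCommGroup E] [InnerProductSpace ℝ E] (α τ : ℝ)
    (x q : ℕ → E) (n : ℕ) : ℝ :=
  τ * ∑ m ∈ Icc 1 n,
    inner ℝ (x m) (∑ j ∈ range (m + 1), galerkinCoeff α τ j • x (m - j) + q m)

theorem dampingWork_eq {α : ℝ} (hα₀ : 0 < α) (hα₂ : α < 2) (τ : ℝ) (x q : ℕ → ℝ) (n : ℕ) :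
    dampingWork α τ x q n = τ *
      (galerkinCoeff α τ 0 / (2 * levyConst (2 - α)) * negNormSq (2 - α) (n + 1) x
        - galerkinCoeff α τ 0 * x 0 ^ 2 + ∑ m ∈ Icc 1 n, x m * q m) := by
  have hκ := levyConst_pos (p := 2 - α) (by linarith) (by linarith)
  have h := sum_mul_sum_galerkinCoeff_mul hα₀ hα₂ τ (n + 1) x
  rw [range_eq_Ico, sum_eq_sum_Ico_succ_bot (Nat.succ_pos n), zero_add, sum_range_one] at h
  rw [div_mul_eq_mul_div, ← h, mul_div_cancel_left₀ _ (by positivity)]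
  simp only [dampingWork, Real.inner_apply, mul_add, sum_add_distrib, smul_eq_mul]
  rw [show Icc 1 n = Ico 1 (n + 1) from rfl]
  ring

theorem exists_le_dampingWork {α c₀ : ℝ} (hα₀ : 0 < α) (hα₁ : α ≤ 1) (hc₀ : 0 < c₀) :
    ∃ c : ℝ, 0 < c ∧ ∀ (n : ℕ) (τ : ℝ) (x q : ℕ → ℝ), 0 < τ →
      (galerkinCoeff α τ 0 * x 0) ^ 2 ≤ c₀ * posNormSq (2 - α) n (halfSeq q) →
      τ * galerkinCoeff α τ 0 / (4 * levyConst (2 - α)) * negNormSq (2 - α) (n / 2 + 1) x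
        ≤ dampingWork α τ x q (n / 2)
          + c * (τ / galerkinCoeff α τ 0 * posNormSq (2 - α) n (halfSeq q)) := by
  have hκ := levyConst_pos (p := 2 - α) (by linarith) (by linarith)
  obtain ⟨c₁, hc₁, h_pair⟩ := exists_sq_sum_le_posNormSq_halfSeq
    (p := 2 - α) (by linarith) (by linarith)
  refine ⟨levyConst (2 - α) * c₁ + c₀, by positivity, fun n τ x q hτ hx₀ => ?_⟩
  have hA := galerkinCoeff_zero_pos (α := α) (by linarith) hτ
  have hS := negNormSq_nonneg (2 - α) (n / 2 + 1) x
  have hL := posNormSq_nonneg (2 - α) n (halfSeq q)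
  have h_sq := h_pair n x q
  rw [dampingWork_eq hα₀ (by linarith)]
  set A := galerkinCoeff α τ 0
  set κ := levyConst (2 - α)
  set S := negNormSq (2 - α) (n / 2 + 1) x
  set L := posNormSq (2 - α) n (halfSeq q)
  have h_young := two_mul_le_add_of_sq_le_mul (r := -∑ m ∈ Icc 1 (n / 2), x m * q m)
    (a := A / (2 * κ) * S) (b := 2 * κ * c₁ / A * L) (by positivity) (by positivity)
    (by rw [neg_sq]; exact h_sq.trans_eq (by field_simp))
  have h_first : A * x 0 ^ 2 ≤ c₀ / A * L := by
    rw [div_mul_eq_mul_div, le_div_iff₀ hA]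
    linarith
  calc τ * A / (4 * κ) * S = τ * (A / (2 * κ) * S - A / (4 * κ) * S) := by field_simp; ring
    _ ≤ τ * (A / (2 * κ) * S - A * x 0 ^ 2 + ∑ m ∈ Icc 1 (n / 2), x m * q m
          + (κ * c₁ / A * L + c₀ / A * L)) := by
        refine mul_le_mul_of_nonneg_left ?_ hτ.le
        have h_half : A / (2 * κ) * S = 2 * (A / (4 * κ) * S) := by field_simp; ring
        have h_half' : 2 * κ * c₁ / A * L = 2 * (κ * c₁ / A * L) := by ring
        linarith
    _ = _ := by ring

theorem dampingWork_truncate (α τ : ℝ) {n N : ℕ} (hn : n ≤ N) (x q : ℕ → ℝ) :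
    dampingWork α τ (fun k => if k ≤ n then x k else 0) q N = dampingWork α τ x q n := by
  refine congrArg (τ * ·) (sum_subset_zero_on_sdiff (Icc_subset_Icc_right hn) (fun m hm => ?_)
    fun m hm => ?_).symm <;> beta_reduce
  · rw [mem_sdiff, mem_Icc, mem_Icc] at hm
    rw [if_neg (by omega), inner_zero_left]
  · have hmn := (mem_Icc.1 hm).2
    simp only [if_pos hmn, if_pos ((Nat.sub_le m _).trans hmn)]

theorem exists_dampingWork_coercive {α c₀ : ℝ} (hα₀ : 0 < α) (hα₁ : α ≤ 1) (hc₀ : 0 < c₀) :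
    ∃ c : ℝ, 0 < c ∧ ∀ (n : ℕ) (τ : ℝ) (x q : ℕ → ℝ), 0 < τ →
      (galerkinCoeff α τ 0 * x 0) ^ 2 ≤ c₀ * posNormSq (2 - α) n (halfSeq q) →
      τ * galerkinCoeff α τ 0 / (4 * levyConst (2 - α)) * negNormSq (2 - α) (n / 2 + 1) x
        ≤ dampingWork α τ x q (n / 2)
          + c * (τ / galerkinCoeff α τ 0 * posNormSq (2 - α) n (halfSeq q)) ∧
      ∀ m ≤ n / 2, 0 ≤ dampingWork α τ x q m
          + c * (τ / galerkinCoeff α τ 0 * posNormSq (2 - α) n (halfSeq q)) := by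
  have hκ := levyConst_pos (p := 2 - α) (by linarith) (by linarith)
  obtain ⟨c, hc, h_le⟩ := exists_le_dampingWork hα₀ hα₁ hc₀
  refine ⟨c, hc, fun n τ x q hτ hx₀ => ⟨h_le n τ x q hτ hx₀, fun m hm => ?_⟩⟩
  have hA := galerkinCoeff_zero_pos (α := α) (by linarith) hτ
  have h := h_le n τ (fun k => if k ≤ m then x k else 0) q hτ hx₀
  rw [dampingWork_truncate α τ hm] at h
  exact (mul_nonneg (by positivity) (negNormSq_nonneg _ _ _)).trans h

/-- `g` takes the value `y k` on the `k`-th cell of the uniform grid with step `h`, for the first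
`n` cells; its values at the grid points are irrelevant for integrals. -/
def IsGridStep (h : ℝ) (n : ℕ) (y : ℕ → ℝ) (g : ℝ → ℝ) : Prop :=
  ∀ k < n, ∀ x ∈ Set.Ioo (k * h) ((k + 1 : ℕ) * h), g x = y k

theorem integral_exp_cell {ω : ℝ} (hω : ω ≠ 0) (h : ℝ) (k : ℕ) :
    ∫ x in (k * h)..((k + 1 : ℕ) * h), Complex.exp (-((ω * x : ℝ) : ℂ) * Complex.I)
      = (Complex.exp (-((h * ω : ℝ) : ℂ) * Complex.I) - 1) / (-(ω : ℂ) * Complex.I)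
        * Complex.exp (-((k * (h * ω) : ℝ) : ℂ) * Complex.I) := by
  have hc : -(ω : ℂ) * Complex.I ≠ 0 :=
    mul_ne_zero (neg_ne_zero.2 (Complex.ofReal_ne_zero.2 hω)) Complex.I_ne_zero
  have h_exp : ∀ x : ℝ, Complex.exp (-((ω * x : ℝ) : ℂ) * Complex.I)
      = Complex.exp (-(ω : ℂ) * Complex.I * x) := fun x => by congr 1; push_cast; ring
  simp only [h_exp]
  rw [integral_exp_mul_complex hc, div_mul_eq_mul_div, sub_mul, one_mul, ← Complex.exp_add]
  congr 3 <;> push_cast <;> ring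

theorem IsGridStep.integral_mul_exp {h : ℝ} (hh : 0 ≤ h) {n : ℕ} {y : ℕ → ℝ} {g : ℝ → ℝ}
    (hg : IsGridStep h n y g) {ω : ℝ} (hω : ω ≠ 0) :
    ∫ x in (0 : ℝ)..(n * h), Complex.exp (-((ω * x : ℝ) : ℂ) * Complex.I) * ((g x : ℝ) : ℂ)
      = (Complex.exp (-((h * ω : ℝ) : ℂ) * Complex.I) - 1) / (-(ω : ℂ) * Complex.I)
        * trigPoly n y (h * ω) := by
  set F : ℝ → ℂ := fun x => Complex.exp (-((ω * x : ℝ) : ℂ) * Complex.I) * ((g x : ℝ) : ℂ) with hF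
  set E : ℝ → ℂ := fun x => Complex.exp (-((ω * x : ℝ) : ℂ) * Complex.I) with hE
  have h_ae : ∀ k < n, ∀ᵐ x : ℝ, x ∈ Set.uIoc (k * h) ((k + 1 : ℕ) * h) → y k • E x = F x := by
    intro k hk
    filter_upwards [Measure.ae_ne volume (((k + 1 : ℕ) : ℝ) * h)] with x hx hx_mem
    rw [Set.uIoc_of_le (by gcongr; exact k.le_succ)] at hx_mem
    simp only [hF, hE, hg k hk x ⟨hx_mem.1, lt_of_le_of_ne hx_mem.2 hx⟩, Complex.real_smul]
    exact mul_comm _ _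
  have h_int : ∀ k < n, IntervalIntegrable F volume (k * h) ((k + 1 : ℕ) * h) := fun k hk =>
    (Continuous.intervalIntegrable (by fun_prop : Continuous fun x => y k • E x) _ _).congr_ae
      ((ae_restrict_iff' measurableSet_uIoc).2 (h_ae k hk))
  have h_sum := intervalIntegral.sum_integral_adjacent_intervals (a := fun k : ℕ => (k : ℝ) * h)
    h_int
  rw [Nat.cast_zero, zero_mul] at h_sum
  rw [← h_sum, trigPoly, mul_sum]
  refine sum_congr rfl fun k hk => ?_
  rw [← intervalIntegral.integral_congr_ae (h_ae k (mem_range.1 hk)),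
    intervalIntegral.integral_smul, integral_exp_cell hω, mul_smul_comm]

theorem norm_sq_exp_neg_ofReal_mul_I_sub_one (t : ℝ) :
    ‖Complex.exp (-(t : ℂ) * Complex.I) - 1‖ ^ 2 = 2 * (1 - Real.cos t) := by
  have h_inner := inner_exp_neg_mul_I t 0
  rw [Complex.ofReal_zero, neg_zero, zero_mul, Complex.exp_zero, sub_zero] at h_inner
  rw [norm_sub_sq_real, h_inner, norm_exp_neg_ofReal_mul_I, norm_one]
  ring

theorem IsGridStep.norm_sq_fourierZeroExt {h : ℝ} (hh : 0 ≤ h) {n : ℕ} {y : ℕ → ℝ} {g : ℝ → ℝ}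
    (hg : IsGridStep h n y g) {ω : ℝ} (hω : ω ≠ 0) :
    ‖fourierZeroExt (n * h) g ω‖ ^ 2 = 1 / (2 * Real.pi) *
      (2 * (1 - Real.cos (h * ω)) / ω ^ 2 * ‖trigPoly n y (h * ω)‖ ^ 2) := by
  rw [fourierZeroExt, hg.integral_mul_exp hh hω, norm_mul, norm_mul, norm_div, mul_pow, mul_pow,
    div_pow, norm_sq_exp_neg_ofReal_mul_I_sub_one, Complex.norm_real, Real.norm_eq_abs, sq_abs,
    div_pow, Real.sq_sqrt (by positivity), norm_mul, Complex.norm_I, mul_one, norm_neg,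
    Complex.norm_real, Real.norm_eq_abs, sq_abs, one_pow]

/-- The squared `H^σ(0, t)` norm of a scalar function; `sobolevNormSq` sums it over the
components. -/
def scalarSobolevNormSq (σ t : ℝ) (g : ℝ → ℝ) : ℝ :=
  ∫ ω : ℝ, (1 + ω ^ 2) ^ σ * ‖fourierZeroExt t g ω‖ ^ 2

theorem one_add_sq_rpow_le {σ ω : ℝ} (hσ : σ ≤ 0) (hω : ω ≠ 0) :
    (1 + ω ^ 2) ^ σ ≤ |ω| ^ (2 * σ) := by
  rw [Real.rpow_mul (abs_nonneg ω), Real.rpow_two, sq_abs]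
  exact Real.rpow_le_rpow_of_nonpos (by positivity) (by linarith) hσ

theorem abs_rpow_le_one_add_sq_rpow {σ : ℝ} (hσ : 0 ≤ σ) (ω : ℝ) :
    |ω| ^ (2 * σ) ≤ (1 + ω ^ 2) ^ σ := by
  rw [Real.rpow_mul (abs_nonneg ω), Real.rpow_two, sq_abs]
  exact Real.rpow_le_rpow (sq_nonneg ω) (by linarith) hσ

theorem IsGridStep.scalarSobolevNormSq_le {p h : ℝ} (hp₁ : 1 ≤ p) (hp₂ : p < 2) (hh : 0 < h)
    {n : ℕ} {y : ℕ → ℝ} {g : ℝ → ℝ} (hg : IsGridStep h n y g) :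
    scalarSobolevNormSq ((1 - p) / 2) (n * h) g ≤ h ^ p / (2 * Real.pi) * negNormSq p n y := by
  set G : ℝ → ℝ := fun θ => fracSymbol p θ * ‖trigPoly n y θ‖ ^ 2 with hG
  have h_int : Integrable fun ω => G (h * ω) := (integrable_comp_mul_left_iff G hh.ne').2
    (integrable_fracSymbol_mul_norm_sq_trigPoly (by linarith) hp₂ n y)
  have h_rpow : ∀ ω : ℝ, ω ≠ 0 → |ω| ^ (1 - p) / ω ^ 2 = h ^ (1 + p) * |h * ω| ^ (-1 - p) := by
    intro ω hω
    rw [abs_mul, abs_of_pos hh, Real.mul_rpow hh.le (abs_nonneg _), ← mul_assoc,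
      ← Real.rpow_add hh, show 1 + p + (-1 - p) = 0 by ring, Real.rpow_zero, one_mul, ← sq_abs,
      ← Real.rpow_two, ← Real.rpow_sub (abs_pos.2 hω)]
    ring_nf
  calc scalarSobolevNormSq ((1 - p) / 2) (n * h) g
      ≤ ∫ ω, h ^ (1 + p) / (2 * Real.pi) * G (h * ω) := by
        refine integral_mono_of_nonneg (.of_forall fun ω => by positivity) (h_int.const_mul _) ?_
        filter_upwards [Measure.ae_ne volume (0 : ℝ)] with ω hω
        have h_weight := one_add_sq_rpow_le (σ := (1 - p) / 2) (by linarith) hω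
        rw [mul_div_cancel₀ _ two_ne_zero] at h_weight
        refine (mul_le_mul_of_nonneg_right h_weight (sq_nonneg _)).trans_eq ?_
        rw [hg.norm_sq_fourierZeroExt hh.le hω, hG]
        simp only [fracSymbol]
        linear_combination (2 * (1 - Real.cos (h * ω)) * ‖trigPoly n y (h * ω)‖ ^ 2
          / (2 * Real.pi)) * h_rpow ω hω
    _ = h ^ p / (2 * Real.pi) * negNormSq p n y := by
        rw [integral_const_mul, Measure.integral_comp_mul_left G, abs_of_pos (by positivity),
          smul_eq_mul, Real.rpow_add hh, Real.rpow_one, negNormSq]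
        field_simp
        rfl

theorem one_sub_cos_mul_div_sq_le (h : ℝ) {ω : ℝ} (hω : ω ≠ 0) :
    2 * (1 - Real.cos (h * ω)) / ω ^ 2 ≤ (h ^ 2 + 4) * (1 + ω ^ 2)⁻¹ := by
  rw [← div_eq_mul_inv, div_le_div_iff₀ (by positivity) (by positivity)]
  have h_quad := Real.one_sub_sq_div_two_le_cos (x := h * ω)
  have h_one := Real.neg_one_le_cos (h * ω)
  nlinarith [sq_nonneg ω]

theorem IsGridStep.integrable_rpow_mul_norm_sq_fourierZeroExt {σ h : ℝ} (hσ : σ < 1 / 2)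
    (hh : 0 ≤ h) {n : ℕ} {y : ℕ → ℝ} {g : ℝ → ℝ} (hg : IsGridStep h n y g) :
    Integrable fun ω : ℝ => (1 + ω ^ 2) ^ σ * ‖fourierZeroExt (n * h) g ω‖ ^ 2 := by
  have h_ae : (fun ω : ℝ => (1 + ω ^ 2) ^ σ * (1 / (2 * Real.pi) *
      (2 * (1 - Real.cos (h * ω)) / ω ^ 2 * ‖trigPoly n y (h * ω)‖ ^ 2)))
      =ᵐ[volume] fun ω => (1 + ω ^ 2) ^ σ * ‖fourierZeroExt (n * h) g ω‖ ^ 2 := by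
    filter_upwards [Measure.ae_ne volume (0 : ℝ)] with ω hω
    rw [hg.norm_sq_fourierZeroExt hh hω]
  have h_dom : Integrable fun ω : ℝ => 1 / (2 * Real.pi) * (h ^ 2 + 4) *
      (∑ k ∈ range n, |y k|) ^ 2 * (1 + ‖ω‖ ^ 2) ^ (-(2 - 2 * σ) / 2) := by
    refine (integrable_rpow_neg_one_add_norm_sq (r := 2 - 2 * σ) ?_).const_mul _
    rw [Module.finrank_self, Nat.cast_one]
    linarith
  refine (h_dom.mono' (Measurable.aestronglyMeasurable (by fun_prop)) ?_).congr h_ae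
  filter_upwards [Measure.ae_ne volume (0 : ℝ)] with ω hω
  have h_cos : 0 ≤ 1 - Real.cos (h * ω) := sub_nonneg.2 (Real.cos_le_one _)
  have h_rpow : (1 + ω ^ 2) ^ (-(2 - 2 * σ) / 2) = (1 + ω ^ 2) ^ σ * (1 + ω ^ 2)⁻¹ := by
    rw [← Real.rpow_neg_one, ← Real.rpow_add (by positivity)]
    ring_nf
  rw [Real.norm_of_nonneg (by positivity), Real.norm_eq_abs, sq_abs, h_rpow]
  calc _ ≤ (1 + ω ^ 2) ^ σ * (1 / (2 * Real.pi) * ((h ^ 2 + 4) * (1 + ω ^ 2)⁻¹ *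
        (∑ k ∈ range n, |y k|) ^ 2)) := by
        gcongr
        exacts [one_sub_cos_mul_div_sq_le h hω, norm_trigPoly_le _ _ _]
    _ = _ := by ring

theorem four_div_pi_sq_mul_sq_le {h ω : ℝ} (hω : ω ≠ 0) (h_abs : |h * ω| ≤ Real.pi) :
    4 / Real.pi ^ 2 * h ^ 2 ≤ 2 * (1 - Real.cos (h * ω)) / ω ^ 2 := by
  rw [le_div_iff₀ (by positivity)]
  have h_cos := Real.cos_le_one_sub_mul_cos_sq h_abs
  linear_combination 2 * h_cos

theorem IsGridStep.rpow_mul_norm_sq_trigPoly_le {p h : ℝ} (hp : 1 ≤ p) (hh : 0 < h)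
    {n : ℕ} {y : ℕ → ℝ} {g : ℝ → ℝ} (hg : IsGridStep h n y g) {ω : ℝ} (hω : ω ≠ 0)
    (h_abs : |h * ω| ≤ Real.pi) :
    |h * ω| ^ (p - 1) * ‖trigPoly n y (h * ω)‖ ^ 2 ≤ Real.pi ^ 3 / 2 * h ^ (p - 3) *
      ((1 + ω ^ 2) ^ ((p - 1) / 2) * ‖fourierZeroExt (n * h) g ω‖ ^ 2) := by
  have h_weight := abs_rpow_le_one_add_sq_rpow (σ := (p - 1) / 2) (by linarith) ω
  rw [mul_div_cancel₀ _ two_ne_zero] at h_weight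
  have h_rpow : h ^ (p - 1) = h ^ (p - 3) * h ^ 2 := by
    rw [← Real.rpow_two, ← Real.rpow_add hh]
    ring_nf
  calc |h * ω| ^ (p - 1) * ‖trigPoly n y (h * ω)‖ ^ 2
      = Real.pi ^ 3 / 2 * h ^ (p - 3) * (|ω| ^ (p - 1) * (1 / (2 * Real.pi) *
          (4 / Real.pi ^ 2 * h ^ 2 * ‖trigPoly n y (h * ω)‖ ^ 2))) := by
        rw [abs_mul, abs_of_pos hh, Real.mul_rpow hh.le (abs_nonneg _), h_rpow]
        field_simp
        norm_num
    _ ≤ _ := by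
        rw [hg.norm_sq_fourierZeroExt hh.le hω]
        gcongr
        exact four_div_pi_sq_mul_sq_le hω h_abs

theorem IsGridStep.posNormSq_le {p h : ℝ} (hp₁ : 1 ≤ p) (hp₂ : p < 2) (hh : 0 < h)
    {n : ℕ} {y : ℕ → ℝ} {g : ℝ → ℝ} (hg : IsGridStep h n y g) :
    posNormSq p n y
      ≤ Real.pi ^ 3 / 2 * h ^ (p - 2) * scalarSobolevNormSq ((p - 1) / 2) (n * h) g := by
  set F : ℝ → ℝ := fun ω => (1 + ω ^ 2) ^ ((p - 1) / 2) * ‖fourierZeroExt (n * h) g ω‖ ^ 2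
  have h_int : Integrable fun θ => Real.pi ^ 3 / 2 * h ^ (p - 3) * F (h⁻¹ * θ) :=
    ((integrable_comp_mul_left_iff F (inv_ne_zero hh.ne')).2
      (hg.integrable_rpow_mul_norm_sq_fourierZeroExt (by linarith) hh.le)).const_mul _
  calc posNormSq p n y
      ≤ ∫ θ in Set.Icc (-Real.pi) Real.pi, Real.pi ^ 3 / 2 * h ^ (p - 3) * F (h⁻¹ * θ) := by
        refine setIntegral_mono_on_ae (integrableOn_rpow_mul_norm_sq_trigPoly hp₁ n y)
          h_int.integrableOn measurableSet_Icc ?_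
        filter_upwards [Measure.ae_ne volume (0 : ℝ)] with θ hθ hθ_mem
        have h_le := hg.rpow_mul_norm_sq_trigPoly_le hp₁ hh (ω := h⁻¹ * θ)
          (mul_ne_zero (inv_ne_zero hh.ne') hθ)
        rw [mul_inv_cancel_left₀ hh.ne'] at h_le
        exact h_le (abs_le.2 hθ_mem)
    _ ≤ ∫ θ, Real.pi ^ 3 / 2 * h ^ (p - 3) * F (h⁻¹ * θ) :=
        setIntegral_le_integral h_int (.of_forall fun θ => by positivity)
    _ = _ := by
        rw [integral_const_mul, Measure.integral_comp_mul_left F, inv_inv, abs_of_pos hh,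
          smul_eq_mul, scalarSobolevNormSq, ← mul_assoc,
          show p - 2 = p - 3 + 1 by ring, Real.rpow_add_one hh.ne', mul_assoc _ (h ^ _)]

/-- The number of half cells in `(0, t̂_{N+})`. -/
def halfCount (J N : ℕ) : ℕ := if N = J then 2 * N else 2 * N + 1

theorem halfCount_div_two (J N : ℕ) : halfCount J N / 2 = N := by
  unfold halfCount
  split_ifs <;> omega

theorem halfCount_le {J N : ℕ} (hN : N ≤ J) : halfCount J N ≤ 2 * J := by
  unfold halfCount
  split_ifs <;> omega

theorem cellRight_eq (T : ℝ) {J : ℕ} (hJ : 1 ≤ J) (N : ℕ) :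
    cellRight T J N = halfCount J N * (T / J / 2) := by
  have hJ₀ : (J : ℝ) ≠ 0 := by positivity
  unfold cellRight halfCount
  split_ifs with h <;> push_cast [h] <;> field_simp

theorem cellLeft_eq (T : ℝ) (J i : ℕ) : cellLeft T J i = (2 * i - 1 : ℕ) * (T / J / 2) := by
  rcases i with _ | i
  · simp [cellLeft]
  · rw [cellLeft, if_neg i.succ_ne_zero, show 2 * (i + 1) - 1 = 2 * i + 1 by omega]
    push_cast
    ring

theorem mem_cell_iff {T : ℝ} (hT : 0 < T) {J n k : ℕ} (hJ : 1 ≤ J) (hk : k < 2 * J) {t : ℝ}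
    (ht : t ∈ Set.Ioo (k * (T / J / 2)) ((k + 1 : ℕ) * (T / J / 2))) :
    t ∈ Set.Icc (cellLeft T J n) (cellRight T J n) ↔ n = (k + 1) / 2 := by
  have hh : 0 < T / J / 2 := by positivity
  rw [Set.mem_Icc, cellLeft_eq, cellRight_eq T hJ]
  constructor
  · rintro ⟨h_left, h_right⟩
    have h_lt : 2 * n - 1 < k + 1 := Nat.cast_lt.1
      (lt_of_mul_lt_mul_right (h_left.trans_lt ht.2) hh.le)
    have h_gt : k < halfCount J n := Nat.cast_lt.1
      (lt_of_mul_lt_mul_right (ht.1.trans_le h_right) hh.le)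
    have h_div := halfCount_div_two J n
    omega
  · intro hn
    have h_le : 2 * n - 1 ≤ k := by omega
    have h_ge : k + 1 ≤ halfCount J n := by
      unfold halfCount
      split_ifs <;> omega
    exact ⟨le_trans (by gcongr) ht.1.le, ht.2.le.trans (by gcongr)⟩

theorem stepFun_eq_halfSeq {d : ℕ} {T : ℝ} (hT : 0 < T) {J k : ℕ} (hJ : 1 ≤ J) (hk : k < 2 * J)
    (w : ℕ → EuclideanSpace ℝ (Fin d)) {t : ℝ}
    (ht : t ∈ Set.Ioo (k * (T / J / 2)) ((k + 1 : ℕ) * (T / J / 2))) :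
    stepFun T J w t = halfSeq w k := by
  rw [stepFun, sum_eq_single_of_mem ((k + 1) / 2) (mem_range.2 (by omega))]
  · exact Set.indicator_of_mem ((mem_cell_iff hT hJ hk ht).2 rfl) _
  · exact fun n _ hn => Set.indicator_of_notMem (fun h => hn ((mem_cell_iff hT hJ hk ht).1 h)) _

theorem isGridStep_app_stepFun {d : ℕ} {T : ℝ} (hT : 0 < T) {J N : ℕ} (hJ : 1 ≤ J) (hN : N ≤ J)
    (A : Matrix (Fin d) (Fin d) ℝ) (w : ℕ → EuclideanSpace ℝ (Fin d)) (i : Fin d) :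
    IsGridStep (T / J / 2) (halfCount J N) (halfSeq fun n => app A (w n) i)
      fun t => app A (stepFun T J w t) i := fun _ hk _ ht =>
  congrArg (fun z => app A z i) (stepFun_eq_halfSeq hT hJ (hk.trans_le (halfCount_le hN)) w ht)

theorem mul_galerkinCoeff_zero (α : ℝ) {τ : ℝ} (hτ : 0 < τ) :
    τ * galerkinCoeff α τ 0 = τ ^ (2 - α) / Real.Gamma (3 - α) := by
  rw [galerkinCoeff, show 2 - α = 1 - α + 1 by ring, Real.rpow_add_one hτ.ne']
  ring

theorem div_galerkinCoeff_zero {α τ : ℝ} (hα : α < 3) (hτ : 0 < τ) :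
    τ / galerkinCoeff α τ 0 = Real.Gamma (3 - α) * τ ^ α := by
  have hΓ : 0 < Real.Gamma (3 - α) := Real.Gamma_pos_of_pos (by linarith)
  have h_rpow : τ ^ α * τ ^ (1 - α) = τ := by
    rw [← Real.rpow_add hτ, add_sub_cancel, Real.rpow_one]
  rw [div_eq_iff (galerkinCoeff_zero_pos hα hτ).ne', galerkinCoeff]
  field_simp
  exact h_rpow.symm

theorem exists_scalarSobolevNormSq_halfSeq_le {α : ℝ} (hα₀ : 0 < α) (hα₁ : α ≤ 1) :
    ∃ c : ℝ, 0 < c ∧ ∀ (n : ℕ) (τ : ℝ) (x : ℕ → ℝ) (g : ℝ → ℝ), 0 < τ →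
      IsGridStep (τ / 2) n (halfSeq x) g →
      scalarSobolevNormSq (-(1 - α) / 2) (n * (τ / 2)) g ≤ c *
        (τ * galerkinCoeff α τ 0 / (4 * levyConst (2 - α)) * negNormSq (2 - α) (n / 2 + 1) x) := by
  have hκ := levyConst_pos (p := 2 - α) (by linarith) (by linarith)
  have hΓ : 0 < Real.Gamma (3 - α) := Real.Gamma_pos_of_pos (by linarith)
  set a := 3 * 2 ^ (2 - α) + 3 / 2 * levyConst (2 - α) * Real.pi ^ (2 - α)
  refine ⟨(1 / 2) ^ (2 - α) / (2 * Real.pi) * a * (4 * levyConst (2 - α) * Real.Gamma (3 - α)),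
    by positivity, fun n τ x g hτ hg => ?_⟩
  calc scalarSobolevNormSq (-(1 - α) / 2) (n * (τ / 2)) g
      ≤ (τ / 2) ^ (2 - α) / (2 * Real.pi) * negNormSq (2 - α) n (halfSeq x) := by
        rw [show -(1 - α) = 1 - (2 - α) by ring]
        exact hg.scalarSobolevNormSq_le (by linarith) (by linarith) (by positivity)
    _ ≤ (τ / 2) ^ (2 - α) / (2 * Real.pi) * (a * negNormSq (2 - α) (n / 2 + 1) x) := by
        gcongr
        exact negNormSq_halfSeq_le (by linarith) (by linarith) n x
    _ = _ := by
        rw [mul_galerkinCoeff_zero α hτ, div_eq_mul_one_div τ,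
          Real.mul_rpow hτ.le (by norm_num)]
        field_simp

theorem exists_div_mul_posNormSq_le {α : ℝ} (hα₀ : 0 < α) (hα₁ : α ≤ 1) :
    ∃ c : ℝ, 0 < c ∧ ∀ (n : ℕ) (τ : ℝ) (y : ℕ → ℝ) (g : ℝ → ℝ), 0 < τ →
      IsGridStep (τ / 2) n y g →
      τ / galerkinCoeff α τ 0 * posNormSq (2 - α) n y
        ≤ c * scalarSobolevNormSq ((1 - α) / 2) (n * (τ / 2)) g := by
  have hΓ : 0 < Real.Gamma (3 - α) := Real.Gamma_pos_of_pos (by linarith)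
  refine ⟨Real.Gamma (3 - α) * (Real.pi ^ 3 / 2 * (1 / 2) ^ (-α)), by positivity,
    fun n τ y g hτ hg => ?_⟩
  have h_le := hg.posNormSq_le (p := 2 - α) (by linarith) (by linarith) (by positivity)
  rw [show 2 - α - 1 = 1 - α by ring, show 2 - α - 2 = -α by ring, div_eq_mul_one_div τ,
    Real.mul_rpow hτ.le (by norm_num), Real.rpow_neg hτ.le, ← div_eq_mul_one_div] at h_le
  calc τ / galerkinCoeff α τ 0 * posNormSq (2 - α) n y
      ≤ Real.Gamma (3 - α) * τ ^ α * (Real.pi ^ 3 / 2 * ((τ ^ α)⁻¹ * (1 / 2) ^ (-α))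
          * scalarSobolevNormSq ((1 - α) / 2) (n * (τ / 2)) g) := by
        rw [div_galerkinCoeff_zero (by linarith) hτ]
        gcongr
    _ = _ := by field_simp

theorem scalarSobolevNormSq_nonneg (σ t : ℝ) (g : ℝ → ℝ) : 0 ≤ scalarSobolevNormSq σ t g :=
  integral_nonneg fun ω => by positivity

theorem exists_scalar_damping_estimate {α : ℝ} (hα₀ : 0 < α) (hα₁ : α < 1) :
    ∃ c : ℝ, 0 < c ∧ ∀ (n : ℕ) (τ s a b : ℝ) (x q : ℕ → ℝ) (g r : ℝ → ℝ), 0 < τ → s ^ 2 = 1 →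
      1 ≤ n / 2 → (2 ≤ n / 2 ∨ rpowSecondDiff (2 - α) 1 ^ 2 ≠ rpowSecondDiff (2 - α) 2) →
      x 0 = 1 / 2 * (a + b) →
      q = (fun k => 1 / 4 * (galerkinCoeff α τ (k + 1) * a + s * galerkinCoeff α τ k * b)) →
      IsGridStep (τ / 2) n (halfSeq x) g → IsGridStep (τ / 2) n (halfSeq q) r →
      scalarSobolevNormSq (-(1 - α) / 2) (n * (τ / 2)) g ≤ c * (dampingWork α τ x q (n / 2)
          + c * scalarSobolevNormSq ((1 - α) / 2) (n * (τ / 2)) r) ∧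
      ∀ m ≤ n / 2, 0 ≤ dampingWork α τ x q m
          + c * scalarSobolevNormSq ((1 - α) / 2) (n * (τ / 2)) r := by
  obtain ⟨c₀, hc₀, h_init⟩ := exists_sq_half_add_le_posNormSq hα₀ hα₁
  obtain ⟨c₁, hc₁, h_work⟩ := exists_dampingWork_coercive hα₀ hα₁.le hc₀
  obtain ⟨c₂, hc₂, h_neg⟩ := exists_scalarSobolevNormSq_halfSeq_le hα₀ hα₁.le
  obtain ⟨c₃, hc₃, h_pos⟩ := exists_div_mul_posNormSq_le hα₀ hα₁.le
  refine ⟨c₂ + c₁ * c₃, by positivity, fun n τ s a b x q g r hτ hs hn hnd hx hq hg hr => ?_⟩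
  have h_work := h_work n τ x q hτ (by rw [hx, hq]; exact h_init n τ s a b hs hn hnd)
  have h_corr : c₁ * (τ / galerkinCoeff α τ 0 * posNormSq (2 - α) n (halfSeq q))
      ≤ (c₂ + c₁ * c₃) * scalarSobolevNormSq ((1 - α) / 2) (n * (τ / 2)) r := by
    calc _ ≤ c₁ * (c₃ * scalarSobolevNormSq ((1 - α) / 2) (n * (τ / 2)) r) := by
          exact mul_le_mul_of_nonneg_left (h_pos n τ _ r hτ hr) hc₁.le
      _ ≤ _ := by
          rw [← mul_assoc]
          exact mul_le_mul_of_nonneg_right (by linarith) (scalarSobolevNormSq_nonneg _ _ _)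
  have h_nonneg : ∀ m ≤ n / 2, 0 ≤ dampingWork α τ x q m
      + (c₂ + c₁ * c₃) * scalarSobolevNormSq ((1 - α) / 2) (n * (τ / 2)) r := fun m hm =>
    (h_work.2 m hm).trans (by gcongr)
  refine ⟨(h_neg n τ x g hτ hg).trans ?_, h_nonneg⟩
  calc _ ≤ c₂ * (dampingWork α τ x q (n / 2)
        + (c₂ + c₁ * c₃) * scalarSobolevNormSq ((1 - α) / 2) (n * (τ / 2)) r) := by
        gcongr
        exact h_work.1.trans (by gcongr)
    _ ≤ _ := mul_le_mul_of_nonneg_right (by linarith [mul_pos hc₁ hc₃]) (h_nonneg _ le_rfl)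

theorem app_eq_toEuclideanLin {d : ℕ} (A : Matrix (Fin d) (Fin d) ℝ) :
    app A = Matrix.toEuclideanLin A := rfl

theorem dampingWork_eq_sum {d : ℕ} (α τ : ℝ) (x q : ℕ → EuclideanSpace ℝ (Fin d)) (n : ℕ) :
    dampingWork α τ x q n = ∑ i, dampingWork α τ (fun k => x k i) (fun k => q k i) n := by
  simp only [dampingWork, ← mul_sum]
  rw [sum_comm]
  simp only [PiLp.inner_apply, PiLp.add_apply, WithLp.ofLp_sum, Finset.sum_apply, PiLp.smul_apply]

/-- The work of the damping force `C (∑_j b_j ṽ_{m-j} + r_0^m)` of the scheme over the steps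
`1, …, n`, written in terms of `C^{1/2} ṽ` and `C^{1/2} r_0`. -/
def schemeWork {d : ℕ} (C : Matrix (Fin d) (Fin d) ℝ) (α τ s : ℝ)
    (v : ℕ → EuclideanSpace ℝ (Fin d)) (n : ℕ) : ℝ :=
  dampingWork α τ (fun k => app (msqrt C) (vTilde v k))
    (fun k => app (msqrt C) (initCorr α τ s v k)) n

theorem rpowSecondDiff_sq_ne {α τ : ℝ} (h : galerkinCoeff α τ 1 ^ 2 ≠
    galerkinCoeff α τ 0 * galerkinCoeff α τ 2) :
    rpowSecondDiff (2 - α) 1 ^ 2 ≠ rpowSecondDiff (2 - α) 2 := by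
  contrapose! h
  rw [galerkinCoeff_of_pos α τ one_pos, galerkinCoeff_of_pos α τ two_pos]
  push_cast
  linear_combination galerkinCoeff α τ 0 ^ 2 * h

theorem exists_damping_estimate {α : ℝ} (hα₀ : 0 < α) (hα₁ : α < 1) : ∃ c : ℝ, 0 < c ∧
    ∀ (d : ℕ) (C : Matrix (Fin d) (Fin d) ℝ) (T : ℝ) (J N : ℕ) (s : ℝ)
      (v : ℕ → EuclideanSpace ℝ (Fin d)), 0 < T → 1 ≤ N → N ≤ J → s ^ 2 = 1 →
      (2 ≤ N ∨ galerkinCoeff α (T / J) 1 ^ 2 ≠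
        galerkinCoeff α (T / J) 0 * galerkinCoeff α (T / J) 2) →
      sobolevNormSq (-(1 - α) / 2) (cellRight T J N)
          (fun t => app (msqrt C) (stepFun T J (vTilde v) t))
        ≤ c * (schemeWork C α (T / J) s v N + c * sobolevNormSq ((1 - α) / 2) (cellRight T J N)
          (fun t => app (msqrt C) (stepFun T J (initCorr α (T / J) s v) t))) ∧
      ∀ m ≤ N, 0 ≤ schemeWork C α (T / J) s v m
          + c * sobolevNormSq ((1 - α) / 2) (cellRight T J N)
            (fun t => app (msqrt C) (stepFun T J (initCorr α (T / J) s v) t)) := by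
  obtain ⟨c, hc, h_scalar⟩ := exists_scalar_damping_estimate hα₀ hα₁
  refine ⟨c, hc, fun d C T J N s v hT hN hNJ hs hnd => ?_⟩
  have hJ : 1 ≤ J := hN.trans hNJ
  have hτ : 0 < T / J := by positivity
  have h_div := halfCount_div_two J N
  have h := fun i : Fin d => h_scalar (halfCount J N) (T / J) s (app (msqrt C) (v 0) i)
    (app (msqrt C) (v 1) i) _ _ _ _ hτ hs (by rwa [h_div])
    (by rw [h_div]; exact hnd.imp_right rpowSecondDiff_sq_ne)
    (by simp only [vTilde, app_eq_toEuclideanLin, map_add, map_smul, PiLp.smul_apply,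
      PiLp.add_apply, smul_eq_mul, add_comm])
    (by simp only [initCorr, app_eq_toEuclideanLin, map_add, map_smul, PiLp.smul_apply,
      PiLp.add_apply, smul_eq_mul])
    (isGridStep_app_stepFun hT hJ hNJ (msqrt C) (vTilde v) i)
    (isGridStep_app_stepFun hT hJ hNJ (msqrt C) (initCorr α (T / J) s v) i)
  simp only [h_div, ← cellRight_eq T hJ] at h
  simp only [schemeWork, dampingWork_eq_sum, sobolevNormSq, mul_sum, ← sum_add_distrib]
  exact ⟨sum_le_sum fun i _ => (h i).1, fun m hm => sum_nonneg fun i _ => (h i).2 m hm⟩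

variable {d : ℕ}

theorem inner_app_msqrt_left (A : Matrix (Fin d) (Fin d) ℝ) (x y : EuclideanSpace ℝ (Fin d)) :
    inner ℝ (app (msqrt A) x) y = inner ℝ x (app (msqrt A) y) :=
  Matrix.isSymmetric_toEuclideanLin_iff.2
    (Matrix.nonneg_iff_posSemidef.1 (CFC.sqrt_nonneg A)).isHermitian x y

theorem app_app (A B : Matrix (Fin d) (Fin d) ℝ) (x : EuclideanSpace ℝ (Fin d)) :
    app A (app B x) = app (A * B) x := by
  simp only [app, Matrix.mulVec_mulVec]

theorem inner_app_eq {A : Matrix (Fin d) (Fin d) ℝ} (hA : A.PosSemidef)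
    (x y : EuclideanSpace ℝ (Fin d)) :
    inner ℝ (app A x) y = inner ℝ (app (msqrt A) x) (app (msqrt A) y) := by
  have h_mul : msqrt A * msqrt A = A :=
    CFC.sqrt_mul_sqrt_self A (Matrix.nonneg_iff_posSemidef.2 hA)
  rw [← inner_app_msqrt_left, app_app, h_mul]

theorem inner_eq_inner_app_inv_msqrt {A : Matrix (Fin d) (Fin d) ℝ} (hA : A.PosDef)
    (f x : EuclideanSpace ℝ (Fin d)) :
    inner ℝ f x = inner ℝ (app (msqrt A)⁻¹ f) (app (msqrt A) x) := by
  have h_unit : IsUnit (msqrt A) := (CFC.isUnit_sqrt_iff A).2 hA.isUnit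
  rw [← inner_app_msqrt_left, app_app,
    Matrix.mul_nonsing_inv _ ((Matrix.isUnit_iff_isUnit_det _).1 h_unit), app_eq_toEuclideanLin]
  simp

theorem inner_app_sub_half_add {A : Matrix (Fin d) (Fin d) ℝ} (hA : A.PosSemidef)
    (x y : EuclideanSpace ℝ (Fin d)) : inner ℝ (app A (x - y)) ((1 / 2 : ℝ) • (x + y))
      = (‖app (msqrt A) x‖ ^ 2 - ‖app (msqrt A) y‖ ^ 2) / 2 := by
  rw [inner_app_eq hA, app_eq_toEuclideanLin, map_sub, map_smul, map_add, inner_smul_right,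
    inner_sub_left, inner_add_right, inner_add_right, real_inner_self_eq_norm_sq,
    real_inner_self_eq_norm_sq, real_inner_comm (Matrix.toEuclideanLin (msqrt A) x)]
  ring

theorem vTilde_succ (v : ℕ → EuclideanSpace ℝ (Fin d)) (n : ℕ) :
    vTilde v (n + 1) = (1 / 2 : ℝ) • (vHat v (n + 1) + vHat v n) := by
  simp only [vHat, vTilde]
  module

/-- The mean displacement `d₀ + τ ∑_{j ≤ n} ṽ_j - τ ṽ_0 / 2`, a discrete antiderivative of `ṽ`:
the argument of `K` in the scheme is the average of two consecutive ones. -/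
def displacement (τ : ℝ) (d₀ : EuclideanSpace ℝ (Fin d)) (v : ℕ → EuclideanSpace ℝ (Fin d))
    (n : ℕ) : EuclideanSpace ℝ (Fin d) :=
  τ • ∑ j ∈ range (n + 1), vTilde v j + (d₀ - (τ / 2) • vTilde v 0)

theorem displacement_succ (τ : ℝ) (d₀ : EuclideanSpace ℝ (Fin d))
    (v : ℕ → EuclideanSpace ℝ (Fin d)) (n : ℕ) :
    displacement τ d₀ v (n + 1) = displacement τ d₀ v n + τ • vTilde v (n + 1) := by
  simp only [displacement, sum_range_succ _ (n + 1), smul_add]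
  abel

theorem add_smul_sum_vTilde (τ : ℝ) (d₀ : EuclideanSpace ℝ (Fin d))
    (v : ℕ → EuclideanSpace ℝ (Fin d)) (n : ℕ) :
    d₀ + τ • ∑ j ∈ Icc 1 (n + 1), (1 / 2 : ℝ) • (vTilde v j + vTilde v (j - 1))
      = (1 / 2 : ℝ) • (displacement τ d₀ v (n + 1) + displacement τ d₀ v n) := by
  induction n with
  | zero =>
    rw [displacement_succ, displacement]
    simp only [zero_add, Icc_self, sum_singleton, range_one, Nat.sub_self]
    module
  | succ n ih =>
    rw [sum_Icc_succ_top (by omega), smul_add, ← add_assoc, ih, displacement_succ τ d₀ v (n + 1),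
      displacement_succ τ d₀ v n, Nat.add_sub_cancel]
    module

/-- Twice the sum of the kinetic energy and the elastic energy at the step `n`. -/
def mechEnergy (M K : Matrix (Fin d) (Fin d) ℝ) (τ : ℝ) (d₀ : EuclideanSpace ℝ (Fin d))
    (v : ℕ → EuclideanSpace ℝ (Fin d)) (n : ℕ) : ℝ :=
  ‖app (msqrt M) (vHat v n)‖ ^ 2 + ‖app (msqrt K) (displacement τ d₀ v n)‖ ^ 2

theorem mechEnergy_succ_sub {M K : Matrix (Fin d) (Fin d) ℝ} (hM : M.PosSemidef)
    (hK : K.PosSemidef) {τ : ℝ} (hτ : τ ≠ 0) (d₀ : EuclideanSpace ℝ (Fin d))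
    (v : ℕ → EuclideanSpace ℝ (Fin d)) (n : ℕ) :
    mechEnergy M K τ d₀ v (n + 1) - mechEnergy M K τ d₀ v n
      = 2 * τ * inner ℝ (app M ((1 / (2 * τ)) • (v (n + 2) - v n))
        + app K (d₀ + τ • ∑ j ∈ Icc 1 (n + 1), (1 / 2 : ℝ) • (vTilde v j + vTilde v (j - 1))))
        (vTilde v (n + 1)) := by
  have h_velocity : (1 / (2 * τ)) • (v (n + 2) - v n) = τ⁻¹ • (vHat v (n + 1) - vHat v n) := by
    rw [one_div, mul_comm, mul_inv, mul_smul, vHat, vHat]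
    congr 1
    module
  have h_kinetic : τ * inner ℝ (app M ((1 / (2 * τ)) • (v (n + 2) - v n))) (vTilde v (n + 1))
      = (‖app (msqrt M) (vHat v (n + 1))‖ ^ 2 - ‖app (msqrt M) (vHat v n)‖ ^ 2) / 2 := by
    rw [← inner_app_sub_half_add hM, ← vTilde_succ, h_velocity, app_eq_toEuclideanLin, map_smul,
      real_inner_smul_left, mul_inv_cancel_left₀ hτ]
  have h_elastic := inner_app_sub_half_add hK (displacement τ d₀ v (n + 1)) (displacement τ d₀ v n)
  rw [← add_smul_sum_vTilde, inner_app_eq hK, real_inner_comm, ← inner_app_eq hK,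
    displacement_succ, add_sub_cancel_left, real_inner_smul_right, ← displacement_succ] at h_elastic
  rw [inner_add_left, mechEnergy, mechEnergy]
  linear_combination -2 * h_kinetic - 2 * h_elastic

theorem schemeWork_succ {C : Matrix (Fin d) (Fin d) ℝ} (hC : C.PosSemidef) (α τ s : ℝ)
    (v : ℕ → EuclideanSpace ℝ (Fin d)) (n : ℕ) :
    schemeWork C α τ s v (n + 1) = schemeWork C α τ s v n + τ * inner ℝ
      (app C (∑ j ∈ range (n + 2), galerkinCoeff α τ j • vTilde v (n + 1 - j)
        + initCorr α τ s v (n + 1))) (vTilde v (n + 1)) := by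
  rw [schemeWork, schemeWork, dampingWork, dampingWork, sum_Icc_succ_top (by omega), mul_add,
    inner_app_eq hC, real_inner_comm (app _ (vTilde v (n + 1)))]
  simp only [app_eq_toEuclideanLin, map_add, map_sum, map_smul]

theorem IsSchemeSolution.energy_step {M C K : Matrix (Fin d) (Fin d) ℝ} (hM : M.PosSemidef)
    (hC : C.PosSemidef) (hK : K.PosSemidef) {α τ s : ℝ} (hτ : τ ≠ 0) {J : ℕ}
    {d₀ : EuclideanSpace ℝ (Fin d)} {v f : ℕ → EuclideanSpace ℝ (Fin d)}
    (h : IsSchemeSolution M C K α τ s J d₀ v f) {n : ℕ} (hn : n < J) :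
    mechEnergy M K τ d₀ v (n + 1) + 2 * schemeWork C α τ s v (n + 1)
      = mechEnergy M K τ d₀ v n + 2 * schemeWork C α τ s v n
        + 2 * τ * inner ℝ (fTilde f (n + 1)) (vTilde v (n + 1)) := by
  have h_scheme := h (n + 1) (mem_Icc.2 ⟨by omega, hn⟩)
  have h_mech := mechEnergy_succ_sub hM hK hτ d₀ v n
  rw [Nat.add_sub_cancel] at h_scheme
  rw [schemeWork_succ hC, ← h_scheme, inner_add_left, inner_add_left]
  rw [inner_add_left] at h_mech
  linear_combination h_mech

theorem inner_vTilde_le {M : Matrix (Fin d) (Fin d) ℝ} (hM : M.PosDef)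
    (y : EuclideanSpace ℝ (Fin d)) (v : ℕ → EuclideanSpace ℝ (Fin d)) (n : ℕ) :
    2 * inner ℝ y (vTilde v (n + 1)) ≤ ‖app (msqrt M)⁻¹ y‖ *
      (‖app (msqrt M) (vHat v (n + 1))‖ + ‖app (msqrt M) (vHat v n)‖) := by
  rw [inner_eq_inner_app_inv_msqrt hM, vTilde_succ, app_eq_toEuclideanLin (msqrt M), map_smul,
    map_add, inner_smul_right, ← mul_assoc, mul_one_div_cancel two_ne_zero, one_mul]
  exact (real_inner_le_norm _ _).trans (by gcongr; exact norm_add_le _ _)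

theorem IsSchemeSolution.mechEnergy_add_schemeWork_le {M C K : Matrix (Fin d) (Fin d) ℝ}
    (hM : M.PosDef) (hC : C.PosSemidef) (hK : K.PosSemidef) {α τ s : ℝ} (hτ : 0 < τ) {J : ℕ}
    {d₀ : EuclideanSpace ℝ (Fin d)} {v f : ℕ → EuclideanSpace ℝ (Fin d)}
    (h : IsSchemeSolution M C K α τ s J d₀ v f) {n : ℕ} (hn : n ≤ J) :
    mechEnergy M K τ d₀ v n + 2 * schemeWork C α τ s v n
      ≤ mechEnergy M K τ d₀ v 0 + ∑ m ∈ Icc 1 n, τ * ‖app (msqrt M)⁻¹ (fTilde f m)‖ *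
          (‖app (msqrt M) (vHat v m)‖ + ‖app (msqrt M) (vHat v (m - 1))‖) := by
  induction n with
  | zero => simp [schemeWork, dampingWork]
  | succ n ih =>
    have h_load := mul_le_mul_of_nonneg_left (inner_vTilde_le hM (fTilde f (n + 1)) v n) hτ.le
    rw [h.energy_step hM.posSemidef hC hK hτ.ne' hn, sum_Icc_succ_top (by omega),
      Nat.add_sub_cancel]
    linarith [ih (by omega)]

-- For the largest value `b` of `|a n|` the hypothesis yields `b ^ 2 ≤ E + 2 G b`.
theorem sq_add_le_of_le_add_sum {N : ℕ} {a u F : ℕ → ℝ} {E : ℝ} (hF : ∀ n, 0 ≤ F n)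
    (hu : ∀ n ≤ N, 0 ≤ u n)
    (h : ∀ n ≤ N, a n ^ 2 + u n ≤ E + ∑ m ∈ Icc 1 n, F m * (a m + a (m - 1))) {n : ℕ}
    (hn : n ≤ N) : a n ^ 2 + u n ≤ 2 * E + 4 * (∑ m ∈ Icc 1 N, F m) ^ 2 := by
  set G := ∑ m ∈ Icc 1 N, F m with hG
  obtain ⟨k, hk, h_max⟩ := exists_max_image (range (N + 1)) (|a ·|) nonempty_range_add_one
  have h_le : ∀ m ≤ N, a m ≤ |a k| := fun m hm =>
    (le_abs_self _).trans (h_max m (mem_range.2 (by omega)))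
  have h_load : ∀ n ≤ N, ∑ m ∈ Icc 1 n, F m * (a m + a (m - 1)) ≤ 2 * G * |a k| := by
    intro n hn
    calc ∑ m ∈ Icc 1 n, F m * (a m + a (m - 1)) ≤ ∑ m ∈ Icc 1 n, F m * (2 * |a k|) := by
          refine sum_le_sum fun m hm => mul_le_mul_of_nonneg_left ?_ (hF m)
          have hmN := (mem_Icc.1 hm).2.trans hn
          linarith [h_le m hmN, h_le (m - 1) (by omega)]
      _ ≤ ∑ m ∈ Icc 1 N, F m * (2 * |a k|) :=
          sum_le_sum_of_subset_of_nonneg (Icc_subset_Icc_right hn) fun m _ _ =>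
            mul_nonneg (hF m) (by positivity)
      _ = 2 * G * |a k| := by rw [hG, ← sum_mul]; ring
  have hkN : k ≤ N := Nat.lt_succ_iff.1 (mem_range.1 hk)
  have h_sq := h k hkN
  rw [← sq_abs] at h_sq
  linarith [h n hn, h_load n hn, h_load k hkN, hu k hkN, sq_nonneg (|a k| - 2 * G)]

theorem norm_add_sq_le (x y : EuclideanSpace ℝ (Fin d)) :
    ‖x + y‖ ^ 2 ≤ 2 * (‖x‖ ^ 2 + ‖y‖ ^ 2) :=
  (pow_le_pow_left₀ (norm_nonneg _) (norm_add_le x y) 2).trans add_sq_le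

theorem norm_sq_app_add_smul_le (A : Matrix (Fin d) (Fin d) ℝ) (x y : EuclideanSpace ℝ (Fin d))
    (τ : ℝ) {e : ℝ} (he : e ^ 2 ≤ 1) :
    ‖app A (x + (e * τ) • y)‖ ^ 2 ≤ 2 * (‖app A x‖ ^ 2 + ‖τ • app A y‖ ^ 2) := by
  have h_sq : ‖e • τ • app A y‖ ^ 2 ≤ ‖τ • app A y‖ ^ 2 := by
    rw [norm_smul, mul_pow, Real.norm_eq_abs, sq_abs]
    exact mul_le_of_le_one_left (sq_nonneg _) he
  have h_add := norm_add_sq_le (app A x) (e • τ • app A y)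
  rw [app_eq_toEuclideanLin] at h_sq h_add ⊢
  rw [map_add, map_smul, mul_smul]
  linarith

theorem mechEnergy_zero_le (M K : Matrix (Fin d) (Fin d) ℝ) (τ : ℝ)
    (d₀ : EuclideanSpace ℝ (Fin d)) (v : ℕ → EuclideanSpace ℝ (Fin d)) :
    mechEnergy M K τ d₀ v 0 ≤ ‖app (msqrt M) (vHat v 0)‖ ^ 2
      + 2 * (‖app (msqrt K) d₀‖ ^ 2 + ‖τ • app (msqrt K) (vTilde v 0)‖ ^ 2) := by
  have h_disp : displacement τ d₀ v 0 = d₀ + (1 / 2 * τ) • vTilde v 0 := by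
    rw [displacement, zero_add, sum_range_one]
    module
  rw [mechEnergy, h_disp]
  gcongr
  exact norm_sq_app_add_smul_le _ _ _ _ (by norm_num)

theorem norm_sq_app_smul_sum_vTilde_le (A : Matrix (Fin d) (Fin d) ℝ) (τ : ℝ)
    (d₀ : EuclideanSpace ℝ (Fin d)) (v : ℕ → EuclideanSpace ℝ (Fin d)) (n : ℕ) :
    ‖app A (τ • ∑ j ∈ range (n + 1), vTilde v j)‖ ^ 2 ≤ 2 * ‖app A (displacement τ d₀ v n)‖ ^ 2
      + 4 * (‖app A d₀‖ ^ 2 + ‖τ • app A (vTilde v 0)‖ ^ 2) := by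
  have h_eq : τ • ∑ j ∈ range (n + 1), vTilde v j
      = displacement τ d₀ v n + -(d₀ + (-1 / 2 * τ) • vTilde v 0) := by
    rw [displacement]
    module
  have h_add := norm_add_sq_le (app A (displacement τ d₀ v n))
    (-app A (d₀ + (-1 / 2 * τ) • vTilde v 0))
  have h_init := norm_sq_app_add_smul_le A d₀ (vTilde v 0) τ (e := -1 / 2) (by norm_num)
  rw [norm_neg] at h_add
  rw [h_eq, app_eq_toEuclideanLin, map_add, map_neg, ← app_eq_toEuclideanLin]
  linarith

theorem sobolevNormSq_nonneg (σ t : ℝ) (g : ℝ → EuclideanSpace ℝ (Fin d)) :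
    0 ≤ sobolevNormSq σ t g :=
  sum_nonneg fun i _ => scalarSobolevNormSq_nonneg σ t fun x => g x i

theorem initialTerms_nonneg (M C K : Matrix (Fin d) (Fin d) ℝ) (α T s : ℝ) (J N : ℕ)
    (d₀ : EuclideanSpace ℝ (Fin d)) (v : ℕ → EuclideanSpace ℝ (Fin d)) :
    0 ≤ initialTerms M C K α T s J N d₀ v :=
  add_nonneg (by positivity) (sobolevNormSq_nonneg _ _ _)

theorem IsSchemeSolution.energy_le {M C K : Matrix (Fin d) (Fin d) ℝ} (hM : M.PosDef)
    (hC : C.PosSemidef) (hK : K.PosSemidef) {α τ s : ℝ} (hτ : 0 < τ) {J N : ℕ}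
    {d₀ : EuclideanSpace ℝ (Fin d)} {v f : ℕ → EuclideanSpace ℝ (Fin d)}
    (h : IsSchemeSolution M C K α τ s J d₀ v f) (hN : N ≤ J) {B : ℝ}
    (hB : ∀ n ≤ N, 0 ≤ schemeWork C α τ s v n + B) {n : ℕ} (hn : n ≤ N) :
    mechEnergy M K τ d₀ v n + 2 * (schemeWork C α τ s v n + B)
      ≤ 2 * (mechEnergy M K τ d₀ v 0 + 2 * B)
        + 4 * (τ * ∑ m ∈ Icc 1 N, ‖app (msqrt M)⁻¹ (fTilde f m)‖) ^ 2 := by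
  rw [mechEnergy, add_assoc, mul_sum]
  refine sq_add_le_of_le_add_sum (a := fun n => ‖app (msqrt M) (vHat v n)‖)
    (u := fun n => ‖app (msqrt K) (displacement τ d₀ v n)‖ ^ 2
      + 2 * (schemeWork C α τ s v n + B))
    (F := fun m => τ * ‖app (msqrt M)⁻¹ (fTilde f m)‖)
    (fun _ => by positivity) (fun n hn => ?_) (fun n hn => ?_) hn
  · linarith [hB n hn, sq_nonneg ‖app (msqrt K) (displacement τ d₀ v n)‖]
  · have h_le := h.mechEnergy_add_schemeWork_le hM hC hK hτ (hn.trans hN)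
    rw [mechEnergy] at h_le
    linarith

theorem IsSchemeSolution.norm_sq_vHat_add_dampStiffEnergy_le {M C K : Matrix (Fin d) (Fin d) ℝ}
    (hM : M.PosDef) (hC : C.PosSemidef) (hK : K.PosSemidef) {α T s : ℝ} (hT : 0 < T) {J N : ℕ}
    {d₀ : EuclideanSpace ℝ (Fin d)} {v f : ℕ → EuclideanSpace ℝ (Fin d)}
    (h : IsSchemeSolution M C K α (T / J) s J d₀ v f) (hJ : 1 ≤ J) (hN : N ≤ J) {c B : ℝ}
    (hc : 0 ≤ c) (hB : ∀ n ≤ N, 0 ≤ schemeWork C α (T / J) s v n + B)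
    (h_sobolev : sobolevNormSq (-(1 - α) / 2) (cellRight T J N)
        (fun t => app (msqrt C) (stepFun T J (vTilde v) t))
      ≤ c * (schemeWork C α (T / J) s v N + B)) {n : ℕ} (hn : n ≤ N) :
    ‖app (msqrt M) (vHat v n)‖ ^ 2 + dampStiffEnergy C K α T J N v
      ≤ (3 + c) * (2 * (mechEnergy M K (T / J) d₀ v 0 + 2 * B)
          + 4 * ((T / J) * ∑ m ∈ Icc 1 N, ‖app (msqrt M)⁻¹ (fTilde f m)‖) ^ 2)
        + 4 * (‖app (msqrt K) d₀‖ ^ 2 + ‖(T / J) • app (msqrt K) (vTilde v 0)‖ ^ 2) := by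
  have hτ : 0 < T / J := by positivity
  have h_energy := fun n hn => h.energy_le hM hC hK hτ hN hB (n := n) hn
  set E := 2 * (mechEnergy M K (T / J) d₀ v 0 + 2 * B)
    + 4 * ((T / J) * ∑ m ∈ Icc 1 N, ‖app (msqrt M)⁻¹ (fTilde f m)‖) ^ 2
  simp only [mechEnergy] at h_energy
  have h_velocity : ‖app (msqrt M) (vHat v n)‖ ^ 2 ≤ E := by
    linarith [h_energy n hn, hB n hn, sq_nonneg ‖app (msqrt K) (displacement (T / J) d₀ v n)‖]
  have h_displacement : ‖app (msqrt K) (displacement (T / J) d₀ v N)‖ ^ 2 ≤ E := by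
    linarith [h_energy N le_rfl, hB N le_rfl, sq_nonneg ‖app (msqrt M) (vHat v N)‖]
  have h_work : schemeWork C α (T / J) s v N + B ≤ E := by
    linarith [h_energy N le_rfl, hB N le_rfl, sq_nonneg ‖app (msqrt M) (vHat v N)‖,
      sq_nonneg ‖app (msqrt K) (displacement (T / J) d₀ v N)‖]
  have h_stiff := norm_sq_app_smul_sum_vTilde_le (msqrt K) (T / J) d₀ v N
  rw [dampStiffEnergy]
  linarith [mul_le_mul_of_nonneg_left h_work hc]

theorem exists_norm_sq_vHat_add_dampStiffEnergy_le {α : ℝ} (hα₀ : 0 < α) (hα₁ : α < 1) :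
    ∃ c : ℝ, 0 < c ∧ ∀ (d : ℕ) (M C K : Matrix (Fin d) (Fin d) ℝ) (T : ℝ) (J N : ℕ) (s : ℝ)
      (d₀ : EuclideanSpace ℝ (Fin d)) (v f : ℕ → EuclideanSpace ℝ (Fin d)),
      M.PosDef → C.PosSemidef → K.PosSemidef → 0 < T → 1 ≤ N → N ≤ J → s ^ 2 = 1 →
      (2 ≤ N ∨ galerkinCoeff α (T / J) 1 ^ 2 ≠
        galerkinCoeff α (T / J) 0 * galerkinCoeff α (T / J) 2) →
      IsSchemeSolution M C K α (T / J) s J d₀ v f → ∀ n ≤ N,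
      ‖app (msqrt M) (vHat v n)‖ ^ 2 + dampStiffEnergy C K α T J N v
        ≤ c * (initialTerms M C K α T s J N d₀ v
          + ((T / J) * ∑ n ∈ Icc 1 N, ‖app (msqrt M)⁻¹ (fTilde f n)‖) ^ 2) := by
  obtain ⟨c, hc, h_damp⟩ := exists_damping_estimate hα₀ hα₁
  refine ⟨(3 + c) * (4 + 4 * c) + 4, by positivity,
    fun d M C K T J N s d₀ v f hM hC hK hT hN hNJ hs hnd h_sol n hn => ?_⟩
  obtain ⟨h_sobolev, h_nonneg⟩ := h_damp d C T J N s v hT hN hNJ hs hnd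
  refine (h_sol.norm_sq_vHat_add_dampStiffEnergy_le hM hC hK hT (hN.trans hNJ) hNJ hc.le
    h_nonneg h_sobolev hn).trans ?_
  have h_init := mechEnergy_zero_le M K (T / J) d₀ v
  have hR := sobolevNormSq_nonneg ((1 - α) / 2) (cellRight T J N)
    fun t => app (msqrt C) (stepFun T J (initCorr α (T / J) s v) t)
  rw [initialTerms]
  set R := sobolevNormSq ((1 - α) / 2) (cellRight T J N)
    fun t => app (msqrt C) (stepFun T J (initCorr α (T / J) s v) t)
  set G := (T / J) * ∑ n ∈ Icc 1 N, ‖app (msqrt M)⁻¹ (fTilde f n)‖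
  set a := ‖app (msqrt M) (vHat v 0)‖ ^ 2
  set k := ‖app (msqrt K) d₀‖ ^ 2
  set l := ‖(T / J) • app (msqrt K) (vTilde v 0)‖ ^ 2
  set I := a + k + l + R
  have h_spare : 0 ≤ 2 * a + 4 * R + 4 * (c * (a + k + l + G ^ 2)) := by positivity
  have h_energy : 2 * (mechEnergy M K (T / J) d₀ v 0 + 2 * (c * R)) + 4 * G ^ 2
      ≤ (4 + 4 * c) * (I + G ^ 2) := by
    linarith
  have h_data : k + l ≤ I + G ^ 2 := by
    linarith [(by positivity : 0 ≤ a + R + G ^ 2)]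
  linarith [mul_le_mul_of_nonneg_left h_energy (by positivity : 0 ≤ 3 + c)]

theorem sq_mul_sum_Icc_le {T : ℝ} (hT : 0 ≤ T) {J N : ℕ} (hN : N ≤ J) (F : ℕ → ℝ) :
    ((T / J) * ∑ n ∈ Icc 1 N, F n) ^ 2 ≤ T * ((T / J) * ∑ n ∈ Icc 1 N, F n ^ 2) := by
  have h_card : T / J * N ≤ T := by
    rw [div_mul_eq_mul_div, mul_div_assoc]
    exact mul_le_of_le_one_right hT (div_le_one_of_le₀ (by exact_mod_cast hN) J.cast_nonneg)
  have h_sq := sq_sum_le_card_mul_sum_sq (s := Icc 1 N) (f := F)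
  rw [Nat.card_Icc, Nat.add_sub_cancel] at h_sq
  calc ((T / J) * ∑ n ∈ Icc 1 N, F n) ^ 2
      ≤ (T / J) ^ 2 * (N * ∑ n ∈ Icc 1 N, F n ^ 2) := by
        rw [mul_pow]
        gcongr
    _ = T / J * N * ((T / J) * ∑ n ∈ Icc 1 N, F n ^ 2) := by ring
    _ ≤ T * ((T / J) * ∑ n ∈ Icc 1 N, F n ^ 2) := by gcongr

end FracNewmark

end

open FracNewmark

theorem theorem1 (α : ℝ) (hα₀ : 0 < α) (hα₁ : α < 1) :
    ∃ c : ℝ, 0 < c ∧ ∀ T : ℝ, 0 < T → ∃ cT : ℝ, 0 < cT ∧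
      ∀ (d : ℕ) (M C K : Matrix (Fin d) (Fin d) ℝ),
        M.PosDef → C.PosSemidef → K.PosSemidef →
      ∀ (J : ℕ), 1 ≤ J →
      ∀ (s : ℝ), s = 1 ∨ s = -1 →
      ∀ (d₀ : EuclideanSpace ℝ (Fin d)) (v f : ℕ → EuclideanSpace ℝ (Fin d)),
        FracNewmark.IsSchemeSolution M C K α (T / J) s J d₀ v f →
      ∀ (N : ℕ) (hN : 1 ≤ N), N ≤ J →
        (2 ≤ N ∨ FracNewmark.galerkinCoeff α (T / J) 1 ^ 2 ≠
          FracNewmark.galerkinCoeff α (T / J) 0 * FracNewmark.galerkinCoeff α (T / J) 2) →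
        (‖FracNewmark.app (FracNewmark.msqrt M) (FracNewmark.vHat v N)‖ ^ 2
            + FracNewmark.dampStiffEnergy C K α T J N v
          ≤ cT * (FracNewmark.initialTerms M C K α T s J N d₀ v
            + (T / J) * ∑ n ∈ Finset.Icc 1 N,
                ‖FracNewmark.app (FracNewmark.msqrt M)⁻¹ (FracNewmark.fTilde f n)‖ ^ 2)) ∧
        ((Finset.Icc 1 N).sup' (Finset.nonempty_Icc.mpr hN)
              (fun n => ‖FracNewmark.app (FracNewmark.msqrt M) (FracNewmark.vHat v n)‖ ^ 2)
            + FracNewmark.dampStiffEnergy C K α T J N v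
          ≤ c * (FracNewmark.initialTerms M C K α T s J N d₀ v
            + ((T / J) * ∑ n ∈ Finset.Icc 1 N,
                ‖FracNewmark.app (FracNewmark.msqrt M)⁻¹ (FracNewmark.fTilde f n)‖) ^ 2)) := by
  obtain ⟨c, hc, h_energy⟩ := exists_norm_sq_vHat_add_dampStiffEnergy_le hα₀ hα₁
  refine ⟨c, hc, fun T hT => ⟨c * (1 + T), by positivity,
    fun d M C K hM hC hK J _ s hs d₀ v f h_sol N hN hNJ hnd => ?_⟩⟩
  have h_bound := h_energy d M C K T J N s d₀ v f hM hC hK hT hN hNJ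
    (sq_eq_one_iff.2 hs) hnd h_sol
  constructor
  · have h_cauchy := sq_mul_sum_Icc_le hT.le hNJ fun n => ‖app (msqrt M)⁻¹ (fTilde f n)‖
    have h_init := initialTerms_nonneg M C K α T s J N d₀ v
    refine (h_bound N le_rfl).trans ?_
    rw [mul_assoc]
    gcongr
    have h_load : 0 ≤ (T / J) * ∑ n ∈ Finset.Icc 1 N, ‖app (msqrt M)⁻¹ (fTilde f n)‖ ^ 2 := by
      positivity
    linarith [mul_nonneg hT.le h_init]
  · rw [← le_sub_iff_add_le]
    exact Finset.sup'_le _ _ fun n hn => le_sub_iff_add_le.2 (h_bound n (Finset.mem_Icc.1 hn).2)
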